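/- Let $r\ge 0$ and $m=2r$. Write real $2m\times 2m$ matrices as $4\times4$ arrays of $r\times r$ blocks. Put $$S=\begin{pmatrix}0&I_r\\-I_r&0\end{pmatrix},\qquad J_a=\begin{pmatrix}-S&0\\0&S\end{pmatrix},\qquad J_b=\begin{pmatrix}0&S\\S&0\end{pmatrix},\qquad J_c=J_aJ_b .$$ For $\gamma\in\{a,b,c\}$ let $\rho_\gamma(A)=J_\gamma^{-1}AJ_\gamma$ on $SO(2m)$ and $\tau_\gamma(V)=J_\gamma^{-1}VJ_\gamma$ on $so(2m)$. Let $Sp(m)\subset SO(2m)$ be the subgroup fixed by $\rho_a,\rho_b,\rho_c$ and $\pi:SO(2m)\to SO(2m)/Sp(m)$ the projection. Let $so(2m)=\mathfrak g_e\oplus\mathfrak g_a\oplus\mathfrak g_b\oplus\mathfrak g_c$ be the $(\mathbb Z_2)^2$-grading in which $\tau_a,\tau_b,\tau_c$ act on $\mathfrak g_e$ by $(1,1,1)$, on $\mathfrak g_a$ by $(-1,1,-1)$, on $\mathfrak g_b$ by $(1,-1,-1)$ and on $\mathfrak g_c$ by $(-1,-1,1)$. The symmetry at the base point is $s_\gamma(\pi(A))=\pi(\rho_\gamma(A))$,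 and the symmetry at $x=\pi(A)$ is $s_{\gamma,x}(y)=A\cdot s_\gamma(A^{-1}\cdot y)$. A non-degenerate (pseudo-Riemannian) $SO(2m)$-invariant metric on $SO(2m)/Sp(m)$ is *adapted* to the $(\mathbb Z_2)^2$-symmetric structure if all the $s_{\gamma,x}$ are isometries. A matrix $V\in\mathfrak g_\gamma$, $\gamma\in\{a,b,c\}$, is determined by its first row of blocks $(X,Y,Z,T)$. These blocks are skew-symmetric, except for one symmetric block, which is $T$ for $\gamma=a$, $Y$ for $\gamma=b$ and $Z$ for $\gamma=c$. Write $\alpha_{\gamma,ij},\beta_{\gamma,ij},\gamma_{\gamma,ij},\delta_{\gamma,ij}$ for the entries at $(i,j)$ of $X,Y,Z,T$. **Proposition.** Let $g$ be a non-degenerate $SO(2m)$-invariant metric on $SO(2m)/Sp(m)$ adapted to the $(\mathbb Z_2)^2$-symmetric structure. Then $g$ is defined by a symmetric bilinear form $B$ on $\mathfrak g_a\oplus\mathfrak g_b\oplus\mathfrak g_c$, extended to $so(2m)$ so that its kernel is $\mathfrak g_e$. That is, $g_{\pi(A)}(d\pi_A(AV),d\pi_A(AW))=B(V,W)$ for all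 $A\in SO(2m)$ and $V,W\in so(2m)$, and $g$ is the only invariant metric with this property. The form $B$ is non-degenerate on $\mathfrak g_a\oplus\mathfrak g_b\oplus\mathfrak g_c$ and $\mathrm{ad}(\mathfrak g_e)$-invariant, and the spaces $\mathfrak g_e,\mathfrak g_a,\mathfrak g_b,\mathfrak g_c$ are mutually orthogonal for $B$. Moreover there are real numbers $\lambda_1^\gamma,\lambda_2^\gamma$ ($\gamma\in\{a,b,c\}$) such that the quadratic form of $B$ is $q_{\mathfrak g_a}+q_{\mathfrak g_b}+q_{\mathfrak g_c}$, i.e. $B(V,V)=q_{\mathfrak g_a}(V_a)+q_{\mathfrak g_b}(V_b)+q_{\mathfrak g_c}(V_c)$ for $V=V_a+V_b+V_c$ with $V_\gamma\in\mathfrak g_\gamma$, where $$q_{\mathfrak g_a}=\lambda_1^a\sum_{i<j}\bigl(\alpha_{a,ij}^2+\beta_{a,ij}^2+\gamma_{a,ij}^2+\delta_{a,ij}^2\bigr)+\lambda_2^a\sum_i\delta_{a,ii}^2+\Bigl(\lambda_2^a-\frac{\lambda_1^a}2\Bigr)\sum_{i\ne j}\delta_{a,ii}\delta_{a,jj},$$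 $$q_{\mathfrak g_b}=\lambda_1^b\sum_{i<j}\bigl(\alpha_{b,ij}^2+\beta_{b,ij}^2+\gamma_{b,ij}^2+\delta_{b,ij}^2\bigr)+\lambda_2^b\sum_i\beta_{b,ii}^2+\Bigl(\lambda_2^b-\frac{\lambda_1^b}2\Bigr)\sum_{i\ne j}\beta_{b,ii}\beta_{b,jj},$$ $$q_{\mathfrak g_c}=\lambda_1^c\sum_{i<j}\bigl(\alpha_{c,ij}^2+\beta_{c,ij}^2+\gamma_{c,ij}^2+\delta_{c,ij}^2\bigr)+\lambda_2^c\sum_i\gamma_{c,ii}^2+\Bigl(\lambda_2^c-\frac{\lambda_1^c}2\Bigr)\sum_{i\ne j}\gamma_{c,ii}\gamma_{c,jj}.$$ The last sums run over ordered pairs $i\neq j$, so that the matrix of $B$ on the diagonal basis vectors of the symmetric block has diagonal entries $\lambda_2^\gamma$ and off-diagonal entries $\lambda_2^\gamma-\lambda_1^\gamma/2$. -/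

import Mathlib

open Matrix
open scoped Kronecker

attribute [local instance 50] Matrix.linftyOpNormedRing Matrix.linftyOpNormedAlgebra
attribute [local instance 100] LieRing.ofAssociativeRing

noncomputable section

namespace SOSp

/-! ### The matrices, the groups and the homogeneous space

Throughout `m = 2 * r`, and the `2 * m = 4 * r` rows and columns are indexed by
`Fin 2 × Fin 2 × Fin r`, so that a matrix is a `2 × 2` array of `2 × 2` arrays of blocks
of size `r`. -/

/-- Row and column indices for matrices of size `2m = 4r`. -/
abbrev Idx (r : ℕ) : Type := Fin 2 × Fin 2 × Fin r

/-- Real matrices of size `2m = 4r`. -/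
abbrev Mat (r : ℕ) : Type := Matrix (Idx r) (Idx r) ℝ

/-- The matrix `S` with blocks `0, I, -I, 0`, of size `m = 2r`. -/
def S (r : ℕ) : Matrix (Fin 2 × Fin r) (Fin 2 × Fin r) ℝ :=
  !![(0 : ℝ), 1; -1, 0] ⊗ₖ (1 : Matrix (Fin r) (Fin r) ℝ)

/-- `J_a`: every entry of `X_a = (-1, 0; 0, 1)` is replaced by that multiple of `S`. -/
def Ja (r : ℕ) : Mat r := !![(-1 : ℝ), 0; 0, 1] ⊗ₖ S r

/-- `J_b`: every entry of `X_b = (0, 1; 1, 0)` is replaced by that multiple of `S`. -/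
def Jb (r : ℕ) : Mat r := !![(0 : ℝ), 1; 1, 0] ⊗ₖ S r

/-- The group `SO(2m)`. -/
abbrev SO (r : ℕ) : Type := ↥(Matrix.specialOrthogonalGroup (Idx r) ℝ)

lemma S_mul_transpose (r : ℕ) : S r * (S r)ᵀ = 1 := by
  have h : (!![(0 : ℝ), 1; -1, 0]) * (!![(0 : ℝ), 1; -1, 0])ᵀ = 1 := by
    ext i j; fin_cases i <;> fin_cases j <;> simp [Matrix.mul_apply]
  rw [S, ← kroneckerMap_transpose, ← mul_kronecker_mul, h]
  simp

lemma S_det (r : ℕ) : (S r).det ^ 2 = 1 := by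
  have h := congrArg Matrix.det (S_mul_transpose r)
  rw [det_mul, det_transpose, det_one] at h
  rw [sq, h]

lemma kronecker_S_mem (r : ℕ) (X : Matrix (Fin 2) (Fin 2) ℝ) (h : X * Xᵀ = 1)
    (hd : X.det = -1) : X ⊗ₖ S r ∈ Matrix.specialOrthogonalGroup (Idx r) ℝ := by
  rw [mem_specialOrthogonalGroup_iff, mem_orthogonalGroup_iff]
  constructor
  · rw [← kroneckerMap_transpose, ← mul_kronecker_mul, S_mul_transpose, h]
    simp
  · rw [det_kronecker, hd]
    simp [S_det, pow_mul]

lemma Ja_mem (r : ℕ) : Ja r ∈ Matrix.specialOrthogonalGroup (Idx r) ℝ := by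
  refine kronecker_S_mem r _ ?_ (by simp [det_fin_two])
  ext i j; fin_cases i <;> fin_cases j <;> simp [Matrix.mul_apply]

lemma Jb_mem (r : ℕ) : Jb r ∈ Matrix.specialOrthogonalGroup (Idx r) ℝ := by
  refine kronecker_S_mem r _ ?_ (by simp [det_fin_two])
  ext i j; fin_cases i <;> fin_cases j <;> simp [Matrix.mul_apply]

/-- The four elements of `Γ = (ℤ/2)²`. -/
inductive Gam : Type
  | e | a | b | c
  deriving DecidableEq

/-- The matrix `J_γ` as an element of `SO(2m)`; here `J_c = J_a J_b`, so that
conjugation by `J_c` is the composite of the conjugations by `J_a` and `J_b`. -/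
def J (r : ℕ) : Gam → SO r
  | .e => 1
  | .a => ⟨Ja r, Ja_mem r⟩
  | .b => ⟨Jb r, Jb_mem r⟩
  | .c => ⟨Ja r, Ja_mem r⟩ * ⟨Jb r, Jb_mem r⟩

/-- The automorphism `ρ_γ(A) = J_γ⁻¹ A J_γ` of `SO(2m)`. -/
def rho (r : ℕ) (γ : Gam) : SO r ≃* SO r := MulAut.conj (J r γ)⁻¹

/-- The subgroup `Sp(m)` of `SO(2m)`: the elements fixed by every `ρ_γ`, that is, the elements
commuting with the anticommuting complex structures `J_a` and `J_b`. -/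
def Sp (r : ℕ) : Subgroup (SO r) where
  carrier := {P | ∀ γ, rho r γ P = P}
  one_mem' := by simp
  mul_mem' := by
    intro P Q hP hQ γ
    rw [map_mul, hP γ, hQ γ]
  inv_mem' := by
    intro P hP γ
    rw [map_inv, hP γ]

/-- The homogeneous space `SO(2m)/Sp(m)`. -/
abbrev M (r : ℕ) : Type := SO r ⧸ Sp r

/-- The canonical projection `π : SO(2m) → SO(2m)/Sp(m)`. -/
def proj (r : ℕ) (A : SO r) : M r := (A : SO r ⧸ Sp r)

/-! ### The smooth structure of the homogeneous space -/

/-- The algebra of smooth functions on `SO(2m)/Sp(m)`: the functions `f` for which `f ∘ π` is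
smooth on `SO(2m)`, that is (`SO(2m)` being a closed submanifold of the space of matrices),
the restriction to `SO(2m)` of a smooth function on the space of matrices. -/
def smoothFn (r : ℕ) : Subalgebra ℝ (M r → ℝ) where
  carrier := {f | ∃ F : Mat r → ℝ, ContDiff ℝ (⊤ : ℕ∞) F ∧ ∀ A : SO r, f (proj r A) = F A}
  mul_mem' := by
    rintro f f' ⟨F, hF, h⟩ ⟨F', hF', h'⟩
    exact ⟨F * F', hF.mul hF', fun A => by simp [h, h']⟩
  add_mem' := by
    rintro f f' ⟨F, hF, h⟩ ⟨F', hF', h'⟩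
    exact ⟨F + F', hF.add hF', fun A => by simp [h, h']⟩
  algebraMap_mem' := fun c => ⟨fun _ => c, contDiff_const, fun _ => rfl⟩

/-- A smooth curve in `SO(2m)`. -/
def IsSmoothLift {r : ℕ} (c : ℝ → SO r) : Prop :=
  ContDiff ℝ (⊤ : ℕ∞) (fun t => (c t : Mat r))

/-- A smooth curve in `SO(2m)/Sp(m)`: the projection of a smooth curve in `SO(2m)`
(smooth curves lift, `π` being a principal bundle). -/
def IsSmoothCurve {r : ℕ} (k : ℝ → M r) : Prop :=
  ∃ c : ℝ → SO r, IsSmoothLift c ∧ ∀ t, k t = proj r (c t)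

/-- The tangent space of `SO(2m)/Sp(m)` at `x`: the space of velocities of smooth curves
through `x`, a velocity being identified with the corresponding derivative of smooth functions
at `x`. -/
def Tan {r : ℕ} (x : M r) : Submodule ℝ (Module.Dual ℝ (smoothFn r)) :=
  Submodule.span ℝ {D | ∃ k : ℝ → M r, IsSmoothCurve k ∧ k 0 = x ∧
    ∀ f : smoothFn r, D f = deriv (fun t => f.1 (k t)) 0}

/-- Smooth maps of `SO(2m)/Sp(m)` to itself: they pull smooth functions back to smooth
functions and carry smooth curves to smooth curves. -/
structure IsSmoothMap {r : ℕ} (φ : M r → M r) : Prop where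
  pullback : ∀ f : smoothFn r, (fun x => f.1 (φ x)) ∈ smoothFn r
  curve : ∀ k : ℝ → M r, IsSmoothCurve k → IsSmoothCurve (fun t => φ (k t))

/-- The pullback of smooth functions along a smooth map. -/
def pull {r : ℕ} {φ : M r → M r} (hφ : IsSmoothMap φ) : smoothFn r →ₗ[ℝ] smoothFn r where
  toFun f := ⟨fun x => f.1 (φ x), hφ.pullback f⟩
  map_add' _ _ := rfl
  map_smul' _ _ := rfl

lemma pull_mem {r : ℕ} {φ : M r → M r} (hφ : IsSmoothMap φ) (x : M r)
    (D : Module.Dual ℝ (smoothFn r)) (hD : D ∈ Tan x) :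
    D.comp (pull hφ) ∈ Tan (φ x) := by
  induction hD using Submodule.span_induction with
  | mem D h =>
    obtain ⟨k, hk, hk0, hD⟩ := h
    exact Submodule.subset_span ⟨fun t => φ (k t), hφ.curve k hk, congrArg φ hk0,
      fun f => hD (pull hφ f)⟩
  | zero => rw [LinearMap.zero_comp]; exact Submodule.zero_mem _
  | add D E _ _ hD hE => rw [LinearMap.add_comp]; exact Submodule.add_mem _ hD hE
  | smul t D _ hD => rw [LinearMap.smul_comp]; exact Submodule.smul_mem _ t hD

/-- The differential `dφ_x : T_x → T_φ(x)` of a smooth map. -/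
def tangentMap {r : ℕ} {φ : M r → M r} (hφ : IsSmoothMap φ) (x : M r) (D : Tan x) : Tan (φ x) :=
  ⟨D.1.comp (pull hφ), pull_mem hφ x D.1 D.2⟩

/-- Smooth vector fields. -/
def IsSmoothField {r : ℕ} (X : ∀ x : M r, Tan x) : Prop :=
  ∀ f : smoothFn r, (fun x => (X x).1 f) ∈ smoothFn r

/-! ### Metrics -/

/-- Non-degenerate (pseudo-Riemannian) metrics on `SO(2m)/Sp(m)`. -/
structure Metric (r : ℕ) where
  form : ∀ x : M r, LinearMap.BilinForm ℝ (Tan x)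
  symm : ∀ x (D E : Tan x), form x D E = form x E D
  nondegenerate : ∀ x (D : Tan x), (∀ E, form x D E = 0) → D = 0
  smooth : ∀ X Y : ∀ x : M r, Tan x, IsSmoothField X → IsSmoothField Y →
    (fun x => form x (X x) (Y x)) ∈ smoothFn r

/-- Isometries of a metric. -/
def Metric.IsIsometry {r : ℕ} (g : Metric r) (φ : M r → M r) : Prop :=
  Function.Bijective φ ∧ ∃ hφ : IsSmoothMap φ, ∀ (x : M r) (D E : Tan x),
    g.form (φ x) (tangentMap hφ x D) (tangentMap hφ x E) = g.form x D E

/-- `SO(2m)`-invariant metrics. -/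
def Metric.IsInvariant {r : ℕ} (g : Metric r) : Prop :=
  ∀ A : SO r, g.IsIsometry (fun x => A • x)

/-- The symmetry `s_γ` at the base point: `π(A) ↦ π(ρ_γ(A))`. -/
def symmBase (r : ℕ) (γ : Gam) : M r → M r :=
  Quotient.map' (rho r γ) (by
    intro A B h
    rw [QuotientGroup.leftRel_apply] at h ⊢
    have h2 := h γ
    rw [map_mul, map_inv] at h2
    rw [h2]
    exact h)

/-- The symmetry `s_(γ,x)` at the point `x = π(A)`: the symmetry at the base point transported
by `A` (it depends on `x` only). -/
def symmAt (r : ℕ) (γ : Gam) (A : SO r) (y : M r) : M r :=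
  A • symmBase r γ (A⁻¹ • y)

/-- Metrics adapted to the `(ℤ/2)²`-symmetric structure: all the symmetries are isometries. -/
def Metric.IsAdapted {r : ℕ} (g : Metric r) : Prop :=
  ∀ (γ : Gam) (A : SO r), g.IsIsometry (symmAt r γ A)

/-! ### The graded Lie algebra -/

/-- The Lie algebra `so(2m)`. -/
abbrev so (r : ℕ) : LieSubalgebra ℝ (Mat r) := LieAlgebra.Orthogonal.so (Idx r) ℝ

/-- `τ_γ(V) = J_γ⁻¹ V J_γ`. -/
def tau {r : ℕ} (γ : Gam) (V : Mat r) : Mat r := ((J r γ)⁻¹ : SO r).1 * V * (J r γ).1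

/-- The sign with which `τ_δ` acts on the component of degree `γ`, as a function of `γ`, `δ`. -/
def sign : Gam → Gam → ℝ
  | .e, _ => 1
  | _, .e => 1
  | .a, .b => 1
  | .b, .a => 1
  | .c, .c => 1
  | _, _ => -1

/-- The component of degree `γ` of `so(2m)`. Thus `𝔤_e` is fixed by all `τ_δ`, and
* `𝔤_a` is the set of `V` with `τ_b V = V`, `τ_a V = τ_c V = -V`;
* `𝔤_b` is the set of `V` with `τ_a V = V`, `τ_b V = τ_c V = -V`;
* `𝔤_c` is the set of `V` with `τ_c V = V`, `τ_a V = τ_b V = -V`. -/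
def grade (r : ℕ) (γ : Gam) : Submodule ℝ (so r) where
  carrier := {V | ∀ δ, tau δ V.1 = sign γ δ • V.1}
  zero_mem' := by intro δ; simp [tau]
  add_mem' := by
    intro V W hV hW δ
    have h1 := hV δ
    have h2 := hW δ
    simp only [tau] at h1 h2 ⊢
    simp [mul_add, add_mul, h1, h2]
  smul_mem' := by
    intro t V hV δ
    have h1 := hV δ
    simp only [tau] at h1 ⊢
    simp [h1, smul_comm t]

lemma exp_mem {r : ℕ} (V : so r) :
    NormedSpace.exp V.1 ∈ Matrix.specialOrthogonalGroup (Idx r) ℝ := by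
  have key : ∀ W : Mat r, Wᵀ = -W → NormedSpace.exp W * (NormedSpace.exp W)ᵀ = 1 := by
    intro W hW
    rw [← Matrix.exp_transpose, hW, ← Matrix.exp_add_of_commute W (-W) (Commute.neg_right rfl)]
    simp
  have hV := (LieAlgebra.Orthogonal.mem_so (Idx r) ℝ V.1).1 V.2
  rw [mem_specialOrthogonalGroup_iff, mem_orthogonalGroup_iff]
  refine ⟨key _ hV, ?_⟩
  have h2 : V.1 = (2⁻¹ : ℝ) • V.1 + (2⁻¹ : ℝ) • V.1 := by
    rw [← add_smul]; norm_num
  have h3 := congrArg Matrix.det (key ((2⁻¹ : ℝ) • V.1) (by rw [transpose_smul, hV, smul_neg]))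
  rw [det_mul, det_transpose, det_one] at h3
  rw [h2, Matrix.exp_add_of_commute _ _ rfl, det_mul, h3]

/-- The curve `t ↦ A exp(tV)` in `SO(2m)`. -/
def expCurve {r : ℕ} (A : SO r) (V : so r) (t : ℝ) : SO r :=
  A * ⟨NormedSpace.exp (t • V).1, exp_mem (t • V)⟩

lemma expCurve_smooth {r : ℕ} (A : SO r) (V : so r) : IsSmoothLift (expCurve A V) := by
  have h : ContDiff ℝ (⊤ : ℕ∞) (fun t : ℝ => NormedSpace.exp (t • V.1)) :=
    (contDiff_iff_contDiffAt.2 fun x : Mat r =>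
      (NormedSpace.exp_analytic (𝕂 := ℝ) x).contDiffAt).comp (contDiff_id.smul contDiff_const)
  exact contDiff_const.mul h

lemma expCurve_zero {r : ℕ} (A : SO r) (V : so r) : expCurve A V 0 = A := by
  apply Subtype.ext
  simp [expCurve]

lemma smooth_comp {r : ℕ} (f : smoothFn r) {c : ℝ → SO r} (hc : IsSmoothLift c) :
    Differentiable ℝ (fun t => f.1 (proj r (c t))) := by
  obtain ⟨F, hF, h⟩ := f.2
  have : (fun t => f.1 (proj r (c t))) = fun t => F (c t) := funext fun t => h (c t)
  rw [this]
  exact (hF.comp hc).differentiable (by simp)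

/-- The image `dπ_A(AV)` in `T_π(A)` of the tangent vector `AV` of `SO(2m)` at `A`: the velocity
at `0` of the curve `t ↦ π(A exp(tV))`. -/
def dproj {r : ℕ} (A : SO r) (V : so r) : Tan (proj r A) :=
  ⟨{ toFun := fun f => deriv (fun t => f.1 (proj r (expCurve A V t))) 0
     map_add' := fun f f' => deriv_add (smooth_comp f (expCurve_smooth A V) 0)
       (smooth_comp f' (expCurve_smooth A V) 0)
     map_smul' := fun s f => deriv_const_mul s (smooth_comp f (expCurve_smooth A V) 0) },
   Submodule.subset_span ⟨fun t => proj r (expCurve A V t),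
     ⟨expCurve A V, expCurve_smooth A V, fun _ => rfl⟩,
     congrArg (proj r) (expCurve_zero A V), fun _ => rfl⟩⟩

/-- The metric `g` is defined by the form `B`: under the identification of the tangent space
at `π(A)` with `so(2m)` modulo the kernel of `V ↦ dπ_A(AV)`, the form `g` becomes `B`. -/
def Metric.IsDefinedBy {r : ℕ} (g : Metric r) (B : LinearMap.BilinForm ℝ (so r)) : Prop :=
  ∀ (A : SO r) (V W : so r), g.form (proj r A) (dproj A V) (dproj A W) = B V W

/-! ### The quadratic forms `q_γ`

A matrix in `𝔤_a`, `𝔤_b` or `𝔤_c` is determined by its first row of blocks `(X, Y, Z, T)`.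
Three of these blocks are skew-symmetric. The fourth one is symmetric: it is `T` on `𝔤_a`,
`Y` on `𝔤_b` and `Z` on `𝔤_c`. The dual bases of the bases of elementary matrices are the
entries `i < j` of the skew-symmetric blocks and the entries `i ≤ j` of the symmetric one. -/

/-- The blocks of the first row of blocks: `X = blk 0 0`, `Y = blk 0 1`, `Z = blk 1 0`,
`T = blk 1 1`. -/
def blk {r : ℕ} (p q : Fin 2) (V : so r) : Matrix (Fin r) (Fin r) ℝ :=
  Matrix.of fun i j => V.1 (0, 0, i) (p, q, j)

/-- The sum of the squares of the entries above the diagonal. -/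
def upperSq {r : ℕ} (X : Matrix (Fin r) (Fin r) ℝ) : ℝ :=
  ∑ i, ∑ j ∈ Finset.Ioi i, X i j ^ 2

/-- The two-parameter quadratic form in three skew-symmetric blocks `P₁, P₂, P₃` and one
symmetric block `Q`. The last sum runs over the ordered pairs `i ≠ j`: the associated bilinear
form takes the value `l₂ - l₁ / 2` on the basis vectors with coordinates `Q i i`, `Q j j`. -/
def qForm {r : ℕ} (l₁ l₂ : ℝ) (P₁ P₂ P₃ Q : Matrix (Fin r) (Fin r) ℝ) : ℝ :=
  l₁ * (upperSq P₁ + upperSq P₂ + upperSq P₃ + upperSq Q) + l₂ * ∑ i, Q i i ^ 2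
    + (l₂ - l₁ / 2) * ∑ i, ∑ j ∈ Finset.univ.erase i, Q i i * Q j j

/-- `q_a` on `𝔤_a`. -/
def qa {r : ℕ} (l₁ l₂ : ℝ) (V : so r) : ℝ :=
  qForm l₁ l₂ (blk 0 0 V) (blk 0 1 V) (blk 1 0 V) (blk 1 1 V)

/-- `q_b` on `𝔤_b`. -/
def qb {r : ℕ} (l₁ l₂ : ℝ) (V : so r) : ℝ :=
  qForm l₁ l₂ (blk 0 0 V) (blk 1 0 V) (blk 1 1 V) (blk 0 1 V)

/-- `q_c` on `𝔤_c`. -/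
def qc {r : ℕ} (l₁ l₂ : ℝ) (V : so r) : ℝ :=
  qForm l₁ l₂ (blk 0 0 V) (blk 0 1 V) (blk 1 1 V) (blk 1 0 V)

end SOSp

end

namespace SOSp

variable {r : ℕ}

/-! An invariant metric is carried by one form on `so(2m)`: pull `g` back along `V ↦ dπ_1(V)` to get
`baseForm g`. Invariance moves this form to every point (`isDefinedBy_baseForm`), and since `dπ_A`
is onto the tangent space (`dprojL_surjective`) the form determines the metric. Its kernel is the
kernel of `dπ_1`, as `g` is non-degenerate. That kernel is `𝔤_e` (`dproj_one_eq_zero_iff`): `exp`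
maps `𝔤_e` into `Sp(m)`, and the functions `π(A) ↦ A J_γ A⁻¹` detect every other direction.

Invariance under `Sp(m)` makes the form `Ad(Sp(m))`-invariant, hence `ad(𝔤_e)`-invariant after
differentiation (`baseForm_ad`). The symmetries give invariance under the `τ_γ`, so components on
which these act by different characters are orthogonal (`orthogonal_of_Ad`), and only the
restriction to each `𝔤_γ` remains.

Each `𝔤_γ`, `γ ≠ e`, contains one matrix `N` among `J_a, J_b, J_c`. It commutes with `𝔤_e = sp(m)`,
and `K ↦ N K` identifies `𝔤_γ`, as an `sp(m)`-module, with the Hermitian `r × r` matrices over the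
quaternions, the commutant of `J_a` and `J_b`. An invariant symmetric form there is `c tr(KL) + ν
tr(K) tr(L)` (`IsAdInvariant.exists_traceForm`): infinitesimal rotations leave two free values on
the diagonal units, and a form vanishing on the diagonal is zero. In block coordinates this is
`qForm` with `λ₁ = 8c` and `λ₂ = 4c + 16ν` (`IsHerm.traceForm_self`), so `λ₂ - λ₁/2 = 16ν`. -/

lemma mem_so_iff (V : Mat r) : V ∈ so r ↔ Vᵀ = -V := LieAlgebra.Orthogonal.mem_so _ _ _

lemma so_transpose (V : so r) : (V.1)ᵀ = -V.1 := (mem_so_iff V.1).1 V.2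

lemma SO_mul_transpose (A : SO r) : A.1 * A.1ᵀ = 1 :=
  (mem_orthogonalGroup_iff _ _).1 (mem_specialOrthogonalGroup_iff.1 A.2).1

lemma SO_transpose_mul (A : SO r) : A.1ᵀ * A.1 = 1 :=
  mul_eq_one_comm.1 (SO_mul_transpose A)

lemma SO_coe_inv (A : SO r) : (A⁻¹ : SO r).1 = A.1ᵀ := rfl

/-! ### Velocities of curves and the tangent spaces -/

lemma hasDerivAt_comp_lift {F : Mat r → ℝ} (hF : ContDiff ℝ (⊤ : ℕ∞) F) {c : ℝ → Mat r}
    {X : Mat r} (hc : HasDerivAt c X 0) :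
    HasDerivAt (fun t => F (c t)) (fderiv ℝ F (c 0) X) 0 :=
  ((hF.differentiable (by simp)) (c 0)).hasFDerivAt.comp_hasDerivAt 0 hc

lemma hasDerivAt_transpose {c : ℝ → Mat r} {X : Mat r} (hc : HasDerivAt c X 0) :
    HasDerivAt (fun t => (c t)ᵀ) Xᵀ 0 :=
  HasFDerivAt.comp_hasDerivAt 0
    (transposeLinearEquiv (Idx r) (Idx r) ℝ ℝ).toLinearMap.toContinuousLinearMap.hasFDerivAt hc

lemma hasDerivAt_exp_curve (V : Mat r) :
    HasDerivAt (fun t : ℝ => NormedSpace.exp (t • V)) V 0 := by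
  have h := hasDerivAt_exp_smul_const (𝕂 := ℝ) V (0 : ℝ)
  rw [zero_smul, NormedSpace.exp_zero, one_mul] at h
  exact h

lemma hasDerivAt_expCurve (A : SO r) (V : so r) :
    HasDerivAt (fun t => (expCurve A V t : Mat r)) (A.1 * V.1) 0 :=
  (hasDerivAt_exp_curve V.1).const_mul A.1

lemma dproj_apply (A : SO r) (V : so r) (f : smoothFn r) {F : Mat r → ℝ}
    (hF : ContDiff ℝ (⊤ : ℕ∞) F) (h : ∀ A : SO r, f.1 (proj r A) = F A) :
    (dproj A V).1 f = fderiv ℝ F A (A.1 * V.1) := by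
  have h1 := (hasDerivAt_comp_lift hF (hasDerivAt_expCurve A V)).deriv
  rw [expCurve_zero] at h1
  rw [← h1]
  simp only [← h]
  rfl

/-- The velocity of the projection of a smooth curve through `A` with velocity `AV`. -/
lemma deriv_proj_lift (A : SO r) (V : so r) {c : ℝ → SO r} (h0 : c 0 = A)
    (hc : HasDerivAt (fun t => (c t : Mat r)) (A.1 * V.1) 0) (f : smoothFn r) :
    deriv (fun t => f.1 (proj r (c t))) 0 = (dproj A V).1 f := by
  obtain ⟨F, hF, h⟩ := f.2
  rw [dproj_apply A V f hF h]
  have h1 := (hasDerivAt_comp_lift hF hc).deriv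
  rw [h0] at h1
  rw [← h1]
  simp only [← h]

/-- The map `V ↦ dπ_A(AV)` as a linear map. -/
noncomputable def dprojL (A : SO r) : so r →ₗ[ℝ] Tan (proj r A) where
  toFun := dproj A
  map_add' V W := by
    refine Subtype.ext (LinearMap.ext fun f => ?_)
    obtain ⟨F, hF, h⟩ := f.2
    change (dproj A (V + W)).1 f = (dproj A V).1 f + (dproj A W).1 f
    simp only [dproj_apply A _ f hF h]
    rw [← map_add, ← mul_add]
    rfl
  map_smul' s V := by
    refine Subtype.ext (LinearMap.ext fun f => ?_)
    obtain ⟨F, hF, h⟩ := f.2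
    change (dproj A (s • V)).1 f = s • (dproj A V).1 f
    simp only [dproj_apply A _ f hF h]
    rw [← map_smul, ← mul_smul_comm]
    rfl

lemma proj_eq_iff (A B : SO r) : proj r A = proj r B ↔ A⁻¹ * B ∈ Sp r := QuotientGroup.eq

lemma proj_mul_of_mem (A : SO r) {P : SO r} (hP : P ∈ Sp r) : proj r (A * P) = proj r A := by
  rw [eq_comm, proj_eq_iff]
  simpa using hP

/-- The velocity of a curve in `SO(2m)` is a left translate of a skew-symmetric matrix. -/
lemma exists_so_of_hasDerivAt {c : ℝ → SO r} {X : Mat r}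
    (hc : HasDerivAt (fun t => (c t : Mat r)) X 0) : ∃ V : so r, X = (c 0).1 * V.1 := by
  have hT : HasDerivAt (fun t => (c t : Mat r)ᵀ) Xᵀ 0 :=
    hasDerivAt_transpose hc
  have h1 := hT.mul hc
  -- Differentiating the constant `cᵀ c = 1` shows that `c(0)ᵀ X` is skew.
  have h2 : (fun t => (c t : Mat r)ᵀ) * (fun t => (c t : Mat r)) = fun _ => 1 :=
    funext fun t => SO_transpose_mul (c t)
  rw [h2] at h1
  have h3 := h1.unique (hasDerivAt_const (0 : ℝ) (1 : Mat r))
  refine ⟨⟨(c 0).1ᵀ * X, ?_⟩, ?_⟩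
  · rw [mem_so_iff, transpose_mul, transpose_transpose]
    exact eq_neg_of_add_eq_zero_left h3
  · rw [← mul_assoc, SO_mul_transpose, one_mul]

lemma dprojL_surjective (A : SO r) : Function.Surjective (dprojL A) := by
  suffices h : Tan (proj r A) ≤ (LinearMap.range (dprojL A)).map (Tan (proj r A)).subtype by
    intro D
    obtain ⟨E, ⟨V, rfl⟩, hE⟩ := h D.2
    exact ⟨V, Subtype.ext hE⟩
  refine Submodule.span_le.2 ?_
  rintro D ⟨k, ⟨c, hc, hk⟩, hk0, hD⟩
  -- A lift of the curve need not start at `A`, only in its coset; right translation by `P ∈ Sp(m)`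
  -- corrects the starting point without changing the projection.
  have hP : (c 0)⁻¹ * A ∈ Sp r := by rw [← proj_eq_iff, ← hk, hk0]
  set P : SO r := (c 0)⁻¹ * A with hPdef
  have h0 : c 0 * P = A := by simp [hPdef]
  have hd : HasDerivAt (fun t => (c t * P : SO r).1) (deriv (fun t => (c t : Mat r)) 0 * P.1) 0 :=
    ((hc.differentiable (by simp)) 0).hasDerivAt.mul_const P.1
  obtain ⟨V, hV⟩ := exists_so_of_hasDerivAt hd
  rw [hV, h0] at hd
  refine ⟨dprojL A V, ⟨V, rfl⟩, LinearMap.ext fun f => ?_⟩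
  rw [hD f]
  change (dproj A V).1 f = _
  rw [← deriv_proj_lift A V (c := fun t => c t * P) h0 hd f]
  simp only [hk, proj_mul_of_mem _ hP]

/-- The differential of a smooth map on a vector `dπ_A(AV)`. -/
lemma tangentMap_dproj {φ : M r → M r} (hφ : IsSmoothMap φ) (A A' : SO r) (V W : so r)
    {c : ℝ → SO r} (hcφ : ∀ t, φ (proj r (expCurve A V t)) = proj r (c t)) (h0 : c 0 = A')
    (hc : HasDerivAt (fun t => (c t : Mat r)) (A'.1 * W.1) 0) :
    (tangentMap hφ (proj r A) (dproj A V)).1 = (dproj A' W).1 := by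
  refine LinearMap.ext fun f => ?_
  rw [← deriv_proj_lift A' W h0 hc f]
  simp only [← hcφ]
  rfl

/-! ### The form at the base point determines the metric -/

lemma form_congr (g : Metric r) {x y : M r} (h : x = y) {D E : Tan x} {D' E' : Tan y}
    (hD : D.1 = D'.1) (hE : E.1 = E'.1) : g.form x D E = g.form y D' E' := by
  subst h
  rw [Subtype.ext hD, Subtype.ext hE]

/-- The form on `so(2m)` that defines an invariant metric. -/
noncomputable def baseForm (g : Metric r) : LinearMap.BilinForm ℝ (so r) :=
  (g.form (proj r 1)).comp (dprojL 1) (dprojL 1)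

lemma baseForm_apply (g : Metric r) (V W : so r) :
    baseForm g V W = g.form (proj r 1) (dproj 1 V) (dproj 1 W) := rfl

lemma baseForm_symm (g : Metric r) (V W : so r) : baseForm g V W = baseForm g W V :=
  g.symm _ _ _

/-- Translation by `A` sends `π(exp(tV))` to `π(A exp(tV))`, so its differential takes `dπ_1(V)` to
`dπ_A(AV)`. -/
lemma isDefinedBy_baseForm {g : Metric r} (hg : g.IsInvariant) : g.IsDefinedBy (baseForm g) := by
  intro A V W
  obtain ⟨-, hφ, h⟩ := hg A
  rw [baseForm_apply, ← h (proj r 1)]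
  have key : ∀ V, (tangentMap hφ (proj r 1) (dproj 1 V)).1 = (dproj A V).1 := fun V =>
    tangentMap_dproj hφ 1 A V V (c := expCurve A V)
      (fun t => congrArg (proj r) (by simp [expCurve])) (expCurve_zero A V)
      (hasDerivAt_expCurve A V)
  exact form_congr g (congrArg (proj r) (mul_one A).symm) (key V).symm (key W).symm

lemma eq_of_isDefinedBy {g g' : Metric r} {B : LinearMap.BilinForm ℝ (so r)}
    (h : g.IsDefinedBy B) (h' : g'.IsDefinedBy B) : g' = g := by
  have hf : g'.form = g.form := by
    funext x
    obtain ⟨A, rfl⟩ := QuotientGroup.mk_surjective x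
    refine LinearMap.ext₂ fun D E => ?_
    obtain ⟨V, rfl⟩ := dprojL_surjective A D
    obtain ⟨W, rfl⟩ := dprojL_surjective A E
    exact (h' A V W).trans (h A V W).symm
  cases g
  cases g'
  subst hf
  rfl

/-! ### The isotropy group and the kernel of the projection -/

lemma J_mul_of_mem_Sp {P : SO r} (hP : P ∈ Sp r) (γ : Gam) : P * J r γ = J r γ * P := by
  have h := hP γ
  simp only [rho, MulAut.conj_apply, inv_inv] at h
  rw [mul_assoc, inv_mul_eq_iff_eq_mul] at h
  exact h

lemma mem_Sp_of_commute {P : SO r} (h : ∀ γ, P.1 * (J r γ).1 = (J r γ).1 * P.1) :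
    P ∈ Sp r := by
  intro γ
  simp only [rho, MulAut.conj_apply, inv_inv]
  rw [mul_assoc, inv_mul_eq_iff_eq_mul]
  exact Subtype.ext (h γ)

lemma tau_eq_iff (γ : Gam) (V W : Mat r) : tau γ V = W ↔ V * (J r γ).1 = (J r γ).1 * W := by
  rw [tau, SO_coe_inv]
  constructor
  · rintro rfl
    rw [← mul_assoc, ← mul_assoc, SO_mul_transpose, one_mul]
  · intro h
    rw [mul_assoc, h, ← mul_assoc, SO_transpose_mul, one_mul]

lemma mem_grade_e (V : so r) :
    V ∈ grade r .e ↔ ∀ γ, V.1 * (J r γ).1 = (J r γ).1 * V.1 := by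
  refine forall_congr' fun γ => ?_
  rw [tau_eq_iff]
  simp [sign]

/-- The smooth functions given by the entries of `A J_γ A⁻¹`. -/
def conjEntry (γ : Gam) (a b : Idx r) : smoothFn r :=
  ⟨fun x => Quotient.liftOn' x (fun A : SO r => (A.1 * (J r γ).1 * A.1ᵀ) a b) (by
    intro A B h
    rw [QuotientGroup.leftRel_apply] at h
    have h1 := congrArg Subtype.val (J_mul_of_mem_Sp h γ)
    obtain ⟨P, hP⟩ : ∃ P, P = A⁻¹ * B := ⟨_, rfl⟩
    have hB : B = A * P := by simp [hP]
    rw [← hP] at h1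
    change P.1 * (J r γ).1 = (J r γ).1 * P.1 at h1
    subst hB
    have h2 : A.1 * P.1 * (J r γ).1 * (A.1 * P.1)ᵀ = A.1 * (J r γ).1 * A.1ᵀ := by
      calc A.1 * P.1 * (J r γ).1 * (A.1 * P.1)ᵀ
          = A.1 * (P.1 * (J r γ).1) * (P.1ᵀ * A.1ᵀ) := by
            rw [transpose_mul, mul_assoc A.1 P.1]
        _ = A.1 * (J r γ).1 * (P.1 * P.1ᵀ) * A.1ᵀ := by rw [h1]; simp only [mul_assoc]
        _ = A.1 * (J r γ).1 * A.1ᵀ := by rw [SO_mul_transpose, mul_one]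
    exact (congrFun (congrFun h2 a) b).symm),
   fun X => (X * (J r γ).1 * Xᵀ) a b, by
    have hT : ContDiff ℝ (⊤ : ℕ∞) (fun X : Mat r => Xᵀ) :=
      ((transposeLinearEquiv (Idx r) (Idx r) ℝ ℝ).toLinearMap.toContinuousLinearMap).contDiff
    exact (((entryLinearMap ℝ ℝ a b).toContinuousLinearMap).contDiff).comp
      ((contDiff_id.mul contDiff_const).mul hT), fun A => rfl⟩

lemma exp_mem_Sp {V : so r} (hV : V ∈ grade r .e) :
    (⟨NormedSpace.exp V.1, exp_mem V⟩ : SO r) ∈ Sp r :=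
  mem_Sp_of_commute fun γ =>
    (Commute.exp_left (show Commute V.1 (J r γ).1 from (mem_grade_e V).1 hV γ)).eq

/-- The entries of `A J_γ Aᵀ` descend to the quotient and have derivative `V J_γ - J_γ V` at `1`
along a skew `V`; a vanishing velocity thus forces `V` to commute with every `J_γ`. Conversely, for
`V ∈ 𝔤_e` the curve `exp(tV)` stays in `Sp(m)` and its projection is constant. -/
lemma dproj_one_eq_zero_iff (V : so r) : dproj 1 V = 0 ↔ V ∈ grade r .e := by
  constructor
  · intro h
    rw [mem_grade_e]
    intro γ
    ext a b
    have h1 : (dproj 1 V).1 (conjEntry γ a b) = 0 := by rw [h]; rfl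
    have h2 : HasDerivAt (fun t => (expCurve 1 V t : Mat r)) V.1 0 := by
      simpa using hasDerivAt_expCurve 1 V
    have h3 : HasDerivAt (fun t => (expCurve 1 V t : Mat r)ᵀ) (V.1)ᵀ 0 :=
      hasDerivAt_transpose h2
    have h4 := ((entryLinearMap ℝ ℝ a b).toContinuousLinearMap).hasFDerivAt.comp_hasDerivAt 0
      ((h2.mul_const (J r γ).1).mul h3)
    have h5 := h4.deriv
    rw [expCurve_zero] at h5
    have h6 := h1.symm.trans h5
    simp only [so_transpose] at h6
    have h7 : (V.1 * (J r γ).1) a b - ((J r γ).1 * V.1) a b = 0 := by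
      change 0 = (V.1 * (J r γ).1 * (1 : Mat r)ᵀ + (1 : Mat r) * (J r γ).1 * -V.1) a b at h6
      simp only [transpose_one, mul_one, one_mul, mul_neg, Matrix.add_apply,
        Matrix.neg_apply] at h6
      linarith
    linarith
  · intro h
    refine Subtype.ext (LinearMap.ext fun f => ?_)
    change deriv (fun t => f.1 (proj r (expCurve 1 V t))) 0 = 0
    simp only [expCurve, proj_mul_of_mem _ (exp_mem_Sp (Submodule.smul_mem _ _ h))]
    simp

lemma baseForm_ker (g : Metric r) (V : so r) :
    (∀ W, baseForm g V W = 0) ↔ V ∈ grade r .e := by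
  rw [← dproj_one_eq_zero_iff]
  constructor
  · intro h
    refine g.nondegenerate _ _ fun E => ?_
    obtain ⟨W, rfl⟩ := dprojL_surjective 1 E
    exact h W
  · intro h W
    rw [baseForm_apply, h]
    simp

/-! ### Invariance under the isotropy group, its Lie algebra and the symmetries -/

/-- The adjoint action of `SO(2m)` on `so(2m)`. -/
def Ad (P : SO r) (V : so r) : so r :=
  ⟨P.1 * V.1 * P.1ᵀ, by
    rw [mem_so_iff, transpose_mul, transpose_mul, transpose_transpose, so_transpose]
    simp [mul_assoc]⟩

lemma hasDerivAt_conj_expCurve (P : SO r) (V : so r) :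
    HasDerivAt (fun t => (P * expCurve 1 V t * P⁻¹ : SO r).1) ((1 : SO r).1 * (Ad P V).1) 0 := by
  have h := ((hasDerivAt_expCurve 1 V).const_mul P.1).mul_const P.1ᵀ
  simp only [OneMemClass.coe_one, one_mul] at h ⊢
  exact h

/-- For `P ∈ Sp(m)` the curves `P exp(tV) P⁻¹` and `P exp(tV)` have the same projection, so this is
the formula for `g` at `A = P`. -/
lemma baseForm_Ad {g : Metric r} (hg : g.IsInvariant) {P : SO r} (hP : P ∈ Sp r) (V W : so r) :
    baseForm g (Ad P V) (Ad P W) = baseForm g V W := by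
  rw [← isDefinedBy_baseForm hg P V W, baseForm_apply]
  have key : ∀ V, (dproj 1 (Ad P V)).1 = (dproj P V).1 := by
    intro V
    refine LinearMap.ext fun f => ?_
    rw [← deriv_proj_lift 1 (Ad P V) (c := fun t => P * expCurve 1 V t * P⁻¹)
      (by simp [expCurve_zero]) (hasDerivAt_conj_expCurve P V) f]
    simp only [proj_mul_of_mem _ (inv_mem hP)]
    rw [← deriv_proj_lift P V (expCurve_zero P V) (hasDerivAt_expCurve P V) f]
    simp [expCurve]
  exact form_congr g (by simpa using (proj_mul_of_mem 1 hP).symm) (key V) (key W)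

/-- The base-point symmetry sends `π(exp(tV))` to `π(J_γ⁻¹ exp(tV) J_γ)`, so its differential is
induced by `τ_γ`. -/
lemma baseForm_tau {g : Metric r} (hg : g.IsAdapted) (γ : Gam) (V W : so r) :
    baseForm g (Ad (J r γ)⁻¹ V) (Ad (J r γ)⁻¹ W) = baseForm g V W := by
  obtain ⟨-, hφ, h⟩ := hg γ 1
  rw [baseForm_apply, baseForm_apply, ← h (proj r 1) (dproj 1 V)]
  have key : ∀ V, (tangentMap hφ (proj r 1) (dproj 1 V)).1 = (dproj 1 (Ad (J r γ)⁻¹ V)).1 :=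
    fun V => tangentMap_dproj hφ 1 1 V (Ad (J r γ)⁻¹ V)
      (c := fun t => (J r γ)⁻¹ * expCurve 1 V t * (J r γ)⁻¹⁻¹)
      (fun t => by
        simp only [symmAt, inv_one, one_smul]
        rfl) (by simp [expCurve_zero]) (hasDerivAt_conj_expCurve _ V)
  refine form_congr g ?_ (key V).symm (key W).symm
  simp only [symmAt, inv_one, one_smul]
  exact (congrArg (proj r) (map_one (rho r γ))).symm

/-- The skew-symmetric part of a matrix. -/
noncomputable def skewPart : Mat r →ₗ[ℝ] so r where
  toFun X := ⟨(2⁻¹ : ℝ) • (X - Xᵀ), by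
    rw [mem_so_iff, transpose_smul, transpose_sub, transpose_transpose, ← smul_neg, neg_sub]⟩
  map_add' X Y := Subtype.ext <| by
    change (2⁻¹ : ℝ) • (X + Y - (X + Y)ᵀ) = (2⁻¹ : ℝ) • (X - Xᵀ) + (2⁻¹ : ℝ) • (Y - Yᵀ)
    rw [transpose_add, ← smul_add]
    congr 1
    abel
  map_smul' t X := Subtype.ext <| by
    change (2⁻¹ : ℝ) • (t • X - (t • X)ᵀ) = t • (2⁻¹ : ℝ) • (X - Xᵀ)
    rw [transpose_smul, ← smul_sub, smul_comm]

lemma skewPart_coe (V : so r) : skewPart V.1 = V := Subtype.ext <| by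
  change (2⁻¹ : ℝ) • (V.1 - V.1ᵀ) = V.1
  rw [so_transpose, sub_neg_eq_add, ← two_smul ℝ, smul_smul]
  norm_num

lemma hasDerivAt_exp_conj (U V : so r) :
    HasDerivAt (fun t => (Ad (expCurve 1 U t) V).1) (⁅U, V⁆ : so r).1 0 := by
  have h2 : HasDerivAt (fun t => (expCurve 1 U t : Mat r)) U.1 0 := by
    simpa using hasDerivAt_expCurve 1 U
  have h3 : HasDerivAt (fun t => (expCurve 1 U t : Mat r)ᵀ) (U.1)ᵀ 0 :=
    hasDerivAt_transpose h2
  have h4 := (h2.mul_const V.1).mul h3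
  rw [expCurve_zero, so_transpose] at h4
  have h5 : (⁅U, V⁆ : so r).1 = U.1 * V.1 * ((1 : SO r).1)ᵀ + (1 : SO r).1 * V.1 * -U.1 := by
    change U.1 * V.1 - V.1 * U.1 = _
    simp [sub_eq_add_neg]
  rw [h5]
  exact h4

lemma baseForm_ad {g : Metric r} (hg : g.IsInvariant) {U : so r} (hU : U ∈ grade r .e)
    (V W : so r) : baseForm g ⁅U, V⁆ W + baseForm g V ⁅U, W⁆ = 0 := by
  -- Composing with the skew part extends the form to all matrices, so that the product rule applies
  -- to matrix-valued curves.
  let b : Mat r →L[ℝ] Mat r →L[ℝ] ℝ :=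
    ((baseForm g).comp skewPart skewPart : LinearMap.BilinForm ℝ (Mat r)).toContinuousBilinearMap
  have hb : ∀ V W : so r, b V.1 W.1 = baseForm g V W := by
    intro V W
    change baseForm g (skewPart V.1) (skewPart W.1) = _
    rw [skewPart_coe, skewPart_coe]
  have hconst : (fun t => b (Ad (expCurve 1 U t) V).1 (Ad (expCurve 1 U t) W).1) =
      fun _ => baseForm g V W := by
    funext t
    rw [hb]
    refine baseForm_Ad hg ?_ V W
    rw [expCurve, one_mul]
    exact exp_mem_Sp (Submodule.smul_mem _ t hU)
  have h := (b.isBoundedBilinearMap.hasFDerivAt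
    ((Ad (expCurve 1 U 0) V).1, (Ad (expCurve 1 U 0) W).1)).comp_hasDerivAt 0
    ((hasDerivAt_exp_conj U V).prodMk (hasDerivAt_exp_conj U W))
  have h0 : ∀ V : so r, Ad (expCurve 1 U 0) V = V := fun V => Subtype.ext <| by
    rw [expCurve_zero]
    simp [Ad]
  have hc : HasDerivAt
      (fun t => b (Ad (expCurve 1 U t) V).1 (Ad (expCurve 1 U t) W).1) 0 0 := by
    rw [hconst]
    exact hasDerivAt_const _ _
  have h1 := HasDerivAt.unique h hc
  simp only [h0] at h1
  rw [← hb, ← hb, add_comm]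
  exact h1

/-! ### Block matrices and the quaternions as a commutant -/

/-- Square matrices of size `4`, acting on the block indices. -/
abbrev Mat4 : Type := Matrix (Fin 2 × Fin 2) (Fin 2 × Fin 2) ℝ

/-- The matrix with entries `q k l * M i j`. -/
def kr (q : Mat4) (M : Matrix (Fin r) (Fin r) ℝ) : Mat r :=
  of fun a b => q (a.1, a.2.1) (b.1, b.2.1) * M a.2.2 b.2.2

lemma kr_eq (q : Mat4) (M : Matrix (Fin r) (Fin r) ℝ) :
    kr q M = (q ⊗ₖ M).submatrix (Equiv.prodAssoc _ _ _).symm (Equiv.prodAssoc _ _ _).symm := rfl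

lemma kr_mul_kr (q q' : Mat4) (M M' : Matrix (Fin r) (Fin r) ℝ) :
    kr q M * kr q' M' = kr (q * q') (M * M') := by
  rw [kr_eq, kr_eq, kr_eq, submatrix_mul_equiv, mul_kronecker_mul]

lemma kr_transpose (q : Mat4) (M : Matrix (Fin r) (Fin r) ℝ) : (kr q M)ᵀ = kr qᵀ Mᵀ := rfl

lemma trace_kr (q : Mat4) (M : Matrix (Fin r) (Fin r) ℝ) :
    (kr q M).trace = q.trace * M.trace := by
  rw [← trace_kronecker, kr_eq]
  exact (Equiv.prodAssoc (Fin 2) (Fin 2) (Fin r)).symm.sum_comp fun a => (q ⊗ₖ M) a a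

/-- `M ↦ (q ↦ kr q M)`, linear in `q`. -/
def krL (M : Matrix (Fin r) (Fin r) ℝ) : Mat4 →ₗ[ℝ] Mat r where
  toFun q := kr q M
  map_add' q q' := by ext a b; exact add_mul _ _ _
  map_smul' t q := by ext a b; exact mul_assoc _ _ _

@[simp] lemma krL_apply (M : Matrix (Fin r) (Fin r) ℝ) (q : Mat4) : krL M q = kr q M := rfl

lemma kr_neg (q : Mat4) (M : Matrix (Fin r) (Fin r) ℝ) : kr (-q) M = -kr q M := map_neg (krL M) q

lemma kr_zero (q : Mat4) : kr q (0 : Matrix (Fin r) (Fin r) ℝ) = 0 := by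
  ext a b; exact mul_zero _

lemma kr_sub_right (q : Mat4) (M M' : Matrix (Fin r) (Fin r) ℝ) :
    kr q (M - M') = kr q M - kr q M' := by
  ext a b; exact mul_sub _ _ _

/-- The `4 × 4` matrix of the entries at `(i, j)` of the blocks. -/
def entry4 (K : Mat r) (i j : Fin r) : Mat4 := of fun k l => K (k.1, k.2, i) (l.1, l.2, j)

lemma sum_idx (f : Idx r → ℝ) : ∑ a, f a = ∑ k : Fin 2 × Fin 2, ∑ i, f (k.1, k.2, i) := by
  rw [← Fintype.sum_prod_type']
  exact ((Equiv.prodAssoc (Fin 2) (Fin 2) (Fin r)).sum_comp f).symm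

lemma entry4_mul_kr_one (K : Mat r) (q : Mat4) (i j : Fin r) :
    entry4 (K * kr q 1) i j = entry4 K i j * q := by
  ext k l
  change ∑ a, K (k.1, k.2, i) a * kr q 1 a (l.1, l.2, j) = ∑ n, entry4 K i j k n * q n l
  rw [sum_idx]
  refine Finset.sum_congr rfl fun n _ => ?_
  simp [kr, entry4, one_apply]

lemma entry4_kr_one_mul (K : Mat r) (q : Mat4) (i j : Fin r) :
    entry4 (kr q 1 * K) i j = q * entry4 K i j := by
  ext k l
  change ∑ a, kr q 1 (k.1, k.2, i) a * K a (l.1, l.2, j) = ∑ n, q k n * entry4 K i j n l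
  rw [sum_idx]
  refine Finset.sum_congr rfl fun n _ => ?_
  simp [kr, entry4, one_apply]

lemma sum_kr_entry4 (K : Mat r) : K = ∑ i, ∑ j, kr (entry4 K i j) (single i j 1) := by
  ext a b
  simp only [Matrix.sum_apply, kr, of_apply, single_apply]
  rw [Finset.sum_eq_single a.2.2, Finset.sum_eq_single b.2.2]
  · simp [entry4]
  · intro j _ hj; simp [hj]
  · simp
  · intro i _ hi; simp [hi]
  · simp

/-- The `4 × 4` matrix of `J_a`. -/
def ja : Mat4 := !![(-1 : ℝ), 0; 0, 1] ⊗ₖ !![(0 : ℝ), 1; -1, 0]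

/-- The `4 × 4` matrix of `J_b`. -/
def jb : Mat4 := !![(0 : ℝ), 1; 1, 0] ⊗ₖ !![(0 : ℝ), 1; -1, 0]

lemma Ja_eq : Ja r = kr ja 1 := by
  ext a b
  simp only [Ja, S, kr, ja, kroneckerMap_apply, of_apply, mul_assoc]

lemma Jb_eq : Jb r = kr jb 1 := by
  ext a b
  simp only [Jb, S, kr, jb, kroneckerMap_apply, of_apply, mul_assoc]

/-- The quaternions, as the commutant of `ja` and `jb`. -/
def IsQuat (q : Mat4) : Prop := q * ja = ja * q ∧ q * jb = jb * q

/-- Imaginary units of the quaternions. -/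
structure IsUnitIm (p : Mat4) : Prop where
  isQuat : IsQuat p
  transpose : pᵀ = -p
  mul_self : p * p = -1

lemma IsQuat.one : IsQuat 1 := by simp [IsQuat]

lemma IsQuat.mul {p q : Mat4} (hp : IsQuat p) (hq : IsQuat q) : IsQuat (p * q) :=
  ⟨by rw [mul_assoc, hq.1, ← mul_assoc, hp.1, mul_assoc],
    by rw [mul_assoc, hq.2, ← mul_assoc, hp.2, mul_assoc]⟩

lemma IsQuat.neg {q : Mat4} (hq : IsQuat q) : IsQuat (-q) :=
  ⟨by rw [neg_mul, mul_neg, hq.1], by rw [neg_mul, mul_neg, hq.2]⟩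

lemma ja_transpose : jaᵀ = -ja := by
  ext ⟨k, k'⟩ ⟨l, l'⟩
  fin_cases k <;> fin_cases k' <;> fin_cases l <;> fin_cases l' <;> simp [ja]

lemma jb_transpose : jbᵀ = -jb := by
  ext ⟨k, k'⟩ ⟨l, l'⟩
  fin_cases k <;> fin_cases k' <;> fin_cases l <;> fin_cases l' <;> simp [jb]

lemma IsQuat.transpose {q : Mat4} (hq : IsQuat q) : IsQuat qᵀ := by
  have h1 := congrArg Matrix.transpose hq.1
  have h2 := congrArg Matrix.transpose hq.2
  rw [transpose_mul, transpose_mul, ja_transpose, neg_mul, mul_neg, neg_inj] at h1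
  rw [transpose_mul, transpose_mul, jb_transpose, neg_mul, mul_neg, neg_inj] at h2
  exact ⟨h1.symm, h2.symm⟩

/-- The first imaginary unit. -/
def quatI : Mat4 := (1 : Matrix (Fin 2) (Fin 2) ℝ) ⊗ₖ !![(0 : ℝ), 1; -1, 0]

/-- The second imaginary unit. -/
def quatJ : Mat4 := !![(0 : ℝ), 1; -1, 0] ⊗ₖ !![(1 : ℝ), 0; 0, -1]

/-- The third imaginary unit. -/
def quatK : Mat4 := !![(0 : ℝ), 1; -1, 0] ⊗ₖ !![(0 : ℝ), 1; 1, 0]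

lemma isUnitIm_kronecker {x y : Matrix (Fin 2) (Fin 2) ℝ} (ha : IsQuat (x ⊗ₖ y))
    (ht : (x ⊗ₖ y)ᵀ = -(x ⊗ₖ y)) (h : (x * x) ⊗ₖ (y * y) = -1) : IsUnitIm (x ⊗ₖ y) :=
  ⟨ha, ht, by rw [← mul_kronecker_mul, h]⟩

lemma isUnitIm_quatI : IsUnitIm quatI := by
  refine isUnitIm_kronecker ⟨?_, ?_⟩ ?_ ?_ <;>
  · try rw [ja]
    try rw [jb]
    try rw [← mul_kronecker_mul, ← mul_kronecker_mul]
    ext ⟨k, k'⟩ ⟨l, l'⟩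
    fin_cases k <;> fin_cases k' <;> fin_cases l <;> fin_cases l' <;> simp

lemma isUnitIm_quatJ : IsUnitIm quatJ := by
  refine isUnitIm_kronecker ⟨?_, ?_⟩ ?_ ?_ <;>
  · try rw [ja]
    try rw [jb]
    try rw [← mul_kronecker_mul, ← mul_kronecker_mul]
    ext ⟨k, k'⟩ ⟨l, l'⟩
    fin_cases k <;> fin_cases k' <;> fin_cases l <;> fin_cases l' <;> simp

lemma isUnitIm_quatK : IsUnitIm quatK := by
  refine isUnitIm_kronecker ⟨?_, ?_⟩ ?_ ?_ <;>
  · try rw [ja]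
    try rw [jb]
    try rw [← mul_kronecker_mul, ← mul_kronecker_mul]
    ext ⟨k, k'⟩ ⟨l, l'⟩
    fin_cases k <;> fin_cases k' <;> fin_cases l <;> fin_cases l' <;> simp

lemma IsQuat.eq_sum {q : Mat4} (hq : IsQuat q) :
    q = q (0, 0) (0, 0) • 1 + q (0, 0) (0, 1) • quatI + q (0, 0) (1, 0) • quatJ
      + q (0, 0) (1, 1) • quatK := by
  have h1 := fun a b c d => congrFun (congrFun hq.1 (a, b)) (c, d)
  have h2 := fun a b c d => congrFun (congrFun hq.2 (a, b)) (c, d)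
  simp only [Matrix.mul_apply, Fintype.sum_prod_type, Fin.sum_univ_two] at h1 h2
  -- `ja` and `jb` permute the rows up to sign, so the relations in rows `(0,0)` and `(0,1)` express
  -- every row of `q` through its first one.
  have e1 := h1 0 0
  have e2 := h2 0 0
  have e3 := h1 0 1
  have e4 := h2 0 1
  simp only [Fin.forall_fin_two] at e1 e2 e3 e4
  simp [ja, jb] at e1 e2 e3 e4
  ext ⟨k, k'⟩ ⟨l, l'⟩
  fin_cases k <;> fin_cases k' <;> fin_cases l <;> fin_cases l' <;>
    simp [quatI, quatJ, quatK, one_apply] <;> linarith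

lemma IsQuat.add_transpose {q : Mat4} (hq : IsQuat q) :
    q + qᵀ = (2 * q (0, 0) (0, 0)) • 1 := by
  have h := hq.eq_sum
  have ht := congrArg Matrix.transpose h
  rw [transpose_add, transpose_add, transpose_add, transpose_smul, transpose_smul, transpose_smul,
    transpose_smul, transpose_one, isUnitIm_quatI.transpose, isUnitIm_quatJ.transpose,
    isUnitIm_quatK.transpose] at ht
  rw [two_mul, add_smul]
  nth_rewrite 1 [h]
  rw [ht]
  simp only [smul_neg]
  abel

lemma IsQuat.map_eq_zero {φ : Mat4 →ₗ[ℝ] ℝ} (h1 : φ 1 = 0) (h : ∀ p, IsUnitIm p → φ p = 0)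
    {q : Mat4} (hq : IsQuat q) : φ q = 0 := by
  rw [hq.eq_sum]
  simp [h1, h _ isUnitIm_quatI, h _ isUnitIm_quatJ, h _ isUnitIm_quatK]

/-! ### Hermitian quaternionic matrices and the action of `sp(m)` -/

/-- The matrices commuting with `J_a` and `J_b`. -/
def IsComm (K : Mat r) : Prop := K * Ja r = Ja r * K ∧ K * Jb r = Jb r * K

/-- Hermitian quaternionic matrices. -/
def IsHerm (K : Mat r) : Prop := IsComm K ∧ Kᵀ = K

lemma isComm_kr {q : Mat4} (hq : IsQuat q) (M : Matrix (Fin r) (Fin r) ℝ) : IsComm (kr q M) := by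
  rw [IsComm, Ja_eq, Jb_eq, kr_mul_kr, kr_mul_kr, kr_mul_kr, kr_mul_kr, hq.1, hq.2, mul_one,
    one_mul]
  exact ⟨rfl, rfl⟩

/-- `J_a` and `J_b` are `ja ⊗ 1` and `jb ⊗ 1`, so they act on each `4 × 4` entry separately:
commuting with them means being an `r × r` matrix of quaternions. -/
lemma IsComm.isQuat {K : Mat r} (hK : IsComm K) (i j : Fin r) : IsQuat (entry4 K i j) := by
  rw [IsComm, Ja_eq, Jb_eq] at hK
  constructor
  · rw [← entry4_mul_kr_one, hK.1, entry4_kr_one_mul]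
  · rw [← entry4_mul_kr_one, hK.2, entry4_kr_one_mul]

lemma IsComm.add {K L : Mat r} (hK : IsComm K) (hL : IsComm L) : IsComm (K + L) :=
  ⟨by rw [add_mul, mul_add, hK.1, hL.1], by rw [add_mul, mul_add, hK.2, hL.2]⟩

/-- The Hermitian matrix `q e_ij + q̄ e_ji`. -/
def hermUnit (q : Mat4) (i j : Fin r) : Mat r := kr q (single i j 1) + kr qᵀ (single j i 1)

/-- The Hermitian matrix `e_ii`. -/
def hermDiag (i : Fin r) : Mat r := kr 1 (single i i 1)

lemma isHerm_hermUnit {q : Mat4} (hq : IsQuat q) (i j : Fin r) : IsHerm (hermUnit q i j) := by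
  refine ⟨(isComm_kr hq _).add (isComm_kr hq.transpose _), ?_⟩
  rw [hermUnit, transpose_add, kr_transpose, kr_transpose, transpose_single, transpose_single,
    transpose_transpose, add_comm]

lemma isHerm_hermDiag (i : Fin r) : IsHerm (hermDiag i) := by
  refine ⟨isComm_kr IsQuat.one _, ?_⟩
  rw [hermDiag, kr_transpose, transpose_single, transpose_one]

lemma hermUnit_transpose (q : Mat4) (i j : Fin r) : hermUnit qᵀ i j = hermUnit q j i := by
  rw [hermUnit, hermUnit, transpose_transpose, add_comm]

lemma hermUnit_self {q : Mat4} (hq : IsQuat q) (i : Fin r) :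
    hermUnit q i i = (2 * q (0, 0) (0, 0)) • hermDiag i := by
  rw [hermUnit, hermDiag, ← krL_apply, ← krL_apply, ← map_add, hq.add_transpose, map_smul,
    krL_apply]

lemma IsHerm.eq_sum {K : Mat r} (hK : IsHerm K) :
    K = (2⁻¹ : ℝ) • ∑ i, ∑ j, hermUnit (entry4 K i j) i j := by
  have h1 := sum_kr_entry4 K
  have h2 := congrArg Matrix.transpose h1
  rw [hK.2] at h2
  simp only [transpose_sum, kr_transpose, transpose_single] at h2
  simp only [hermUnit, Finset.sum_add_distrib]
  rw [← h1, ← h2, ← two_smul ℝ, smul_smul]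
  norm_num

/-- Forms on Hermitian matrices invariant under the adjoint action of `sp(m)`. -/
def IsAdInvariant (b : LinearMap.BilinForm ℝ (Mat r)) : Prop :=
  ∀ U : Mat r, IsComm U → Uᵀ = -U → ∀ K L : Mat r, IsHerm K → IsHerm L →
    b (U * K - K * U) L + b K (U * L - L * U) = 0

lemma isComm_imDiag {p : Mat4} (hp : IsUnitIm p) (i : Fin r) : IsComm (kr p (single i i 1)) :=
  isComm_kr hp.isQuat _

lemma imDiag_transpose {p : Mat4} (hp : IsUnitIm p) (i : Fin r) :
    (kr p (single i i 1))ᵀ = -kr p (single i i 1) := by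
  rw [kr_transpose, hp.transpose, transpose_single, kr_neg]

lemma imDiag_ad_hermUnit {p : Mat4} (hp : IsUnitIm p) (q : Mat4) {i j : Fin r} (hij : i ≠ j) :
    kr p (single i i 1) * hermUnit q i j - hermUnit q i j * kr p (single i i 1)
      = hermUnit (p * q) i j := by
  simp only [hermUnit, mul_add, add_mul, kr_mul_kr, single_mul_single_same,
    single_mul_single_of_ne _ _ _ _ hij, single_mul_single_of_ne _ _ _ _ hij.symm, kr_zero,
    mul_one, transpose_mul, hp.transpose, mul_neg, kr_neg]
  abel

lemma imDiag_ad_hermUnit_of_ne (p q : Mat4) {k i j : Fin r} (hi : k ≠ i) (hj : k ≠ j) :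
    kr p (single k k 1) * hermUnit q i j - hermUnit q i j * kr p (single k k 1) = 0 := by
  simp only [hermUnit, mul_add, add_mul, kr_mul_kr, single_mul_single_of_ne _ _ _ _ hi,
    single_mul_single_of_ne _ _ _ _ hi.symm, single_mul_single_of_ne _ _ _ _ hj,
    single_mul_single_of_ne _ _ _ _ hj.symm, kr_zero, add_zero, sub_zero]

/-- The infinitesimal rotation in the plane of two coordinates. -/
def rot (i j : Fin r) : Mat r := kr 1 (single i j 1 - single j i 1)

lemma isComm_rot (i j : Fin r) : IsComm (rot i j) := isComm_kr IsQuat.one _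

lemma rot_transpose (i j : Fin r) : (rot i j)ᵀ = -rot i j := by
  rw [rot, kr_transpose, transpose_sub, transpose_single, transpose_single, transpose_one,
    kr_sub_right, kr_sub_right, neg_sub]

lemma rot_ad_left {i j : Fin r} (hij : i ≠ j) :
    rot i j * hermDiag i - hermDiag i * rot i j = -hermUnit 1 i j := by
  simp only [hermUnit, hermDiag, rot, kr_sub_right, mul_sub, sub_mul, kr_mul_kr,
    single_mul_single_same, single_mul_single_of_ne _ _ _ _ hij,
    single_mul_single_of_ne _ _ _ _ hij.symm, kr_zero, mul_one, transpose_one]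
  abel

lemma rot_ad_right {i j : Fin r} (hij : i ≠ j) :
    rot i j * hermDiag j - hermDiag j * rot i j = hermUnit 1 i j := by
  simp only [hermUnit, hermDiag, rot, kr_sub_right, mul_sub, sub_mul, kr_mul_kr,
    single_mul_single_same, single_mul_single_of_ne _ _ _ _ hij,
    single_mul_single_of_ne _ _ _ _ hij.symm, kr_zero, mul_one, transpose_one]
  abel

lemma rot_ad_of_ne {i j k : Fin r} (hi : k ≠ i) (hj : k ≠ j) :
    rot i j * hermDiag k - hermDiag k * rot i j = 0 := by
  simp only [hermDiag, rot, kr_sub_right, mul_sub, sub_mul, kr_mul_kr,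
    single_mul_single_of_ne _ _ _ _ hi, single_mul_single_of_ne _ _ _ _ hi.symm,
    single_mul_single_of_ne _ _ _ _ hj, single_mul_single_of_ne _ _ _ _ hj.symm, kr_zero,
    sub_zero]

lemma rot_ad_hermUnit {i j : Fin r} (hij : i ≠ j) :
    rot i j * hermUnit 1 i j - hermUnit 1 i j * rot i j
      = (2 : ℝ) • (hermDiag i - hermDiag j) := by
  simp only [hermUnit, hermDiag, rot, kr_sub_right, mul_sub, sub_mul, mul_add, add_mul, kr_mul_kr,
    single_mul_single_same, single_mul_single_of_ne _ _ _ _ hij,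
    single_mul_single_of_ne _ _ _ _ hij.symm, kr_zero, mul_one, transpose_one, two_smul]
  abel

/-! ### Classification of the invariant forms -/

section Invariant

variable {b : LinearMap.BilinForm ℝ (Mat r)}

/-- The imaginary diagonal matrix `I e_ii` kills the second argument, whose indices avoid `i`, but
maps the unit with coefficient `-(I q)` to the unit with coefficient `q`. -/
lemma IsAdInvariant.hermUnit_of_ne (hb : IsAdInvariant b) {q q' : Mat4} (hq : IsQuat q)
    (hq' : IsQuat q') {i j k l : Fin r} (hij : i ≠ j) (hk : i ≠ k) (hl : i ≠ l) :
    b (hermUnit q i j) (hermUnit q' k l) = 0 := by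
  have hp := isUnitIm_quatI
  have h := hb _ (isComm_imDiag hp i) (imDiag_transpose hp i) _ _
    (isHerm_hermUnit (hp.isQuat.mul hq).neg i j) (isHerm_hermUnit hq' k l)
  rw [imDiag_ad_hermUnit hp _ hij, imDiag_ad_hermUnit_of_ne _ _ hk hl, mul_neg, ← mul_assoc,
    hp.mul_self, neg_one_mul, neg_neg] at h
  simpa using h

/-- Invariance under the infinitesimal rotation in the plane `(i, j)`, tested on `e_ii` and the real
off-diagonal unit, which the rotation exchanges up to `e_jj`. -/
lemma IsAdInvariant.diag_rel (hb : IsAdInvariant b) {i j : Fin r} (hij : i ≠ j) :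
    b (hermUnit 1 i j) (hermUnit 1 i j)
      = 2 * (b (hermDiag i) (hermDiag i) - b (hermDiag i) (hermDiag j)) := by
  have h := hb _ (isComm_rot i j) (rot_transpose i j) _ _ (isHerm_hermDiag i)
    (isHerm_hermUnit IsQuat.one i j)
  rw [rot_ad_left hij, rot_ad_hermUnit hij] at h
  simp only [map_neg, map_smul, map_sub, LinearMap.neg_apply, smul_eq_mul] at h
  linarith

lemma IsAdInvariant.diag_rel' (hb : IsAdInvariant b) {i j : Fin r} (hij : i ≠ j) :
    b (hermUnit 1 i j) (hermUnit 1 i j)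
      = 2 * (b (hermDiag j) (hermDiag j) - b (hermDiag j) (hermDiag i)) := by
  have h := hb _ (isComm_rot i j) (rot_transpose i j) _ _ (isHerm_hermDiag j)
    (isHerm_hermUnit IsQuat.one i j)
  rw [rot_ad_right hij, rot_ad_hermUnit hij] at h
  simp only [map_smul, map_sub, smul_eq_mul] at h
  linarith

lemma IsAdInvariant.diag_off (hb : IsAdInvariant b) {i j k : Fin r} (hij : i ≠ j)
    (hi : k ≠ i) (hj : k ≠ j) :
    b (hermDiag i) (hermDiag k) = b (hermDiag j) (hermDiag k) := by
  have h := hb _ (isComm_rot i j) (rot_transpose i j) _ _ (isHerm_hermUnit IsQuat.one i j)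
    (isHerm_hermDiag k)
  rw [rot_ad_hermUnit hij, rot_ad_of_ne hi hj] at h
  simp only [map_smul, map_sub, map_zero, LinearMap.smul_apply, LinearMap.sub_apply,
    smul_eq_mul] at h
  linarith

/-- The values of an invariant form on the diagonal. -/
lemma IsAdInvariant.exists_diag (hb : IsAdInvariant b) (hs : ∀ K L, b K L = b L K) :
    ∃ x y : ℝ, ∀ i j, b (hermDiag i) (hermDiag j) = if i = j then x else y := by
  have hd : ∀ i j : Fin r, b (hermDiag i) (hermDiag i) = b (hermDiag j) (hermDiag j) := by
    intro i j
    by_cases hij : i = j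
    · rw [hij]
    have h1 := hb.diag_rel hij
    have h2 := hb.diag_rel' hij
    rw [hs (hermDiag j) (hermDiag i)] at h2
    linarith
  have ho : ∀ i j k : Fin r, k ≠ i → k ≠ j →
      b (hermDiag i) (hermDiag k) = b (hermDiag j) (hermDiag k) := by
    intro i j k hi hj
    by_cases hij : i = j
    · rw [hij]
    exact hb.diag_off hij hi hj
  -- For `r = 1` there is no off-diagonal value and `y` is arbitrary; for `r = 0` both are.
  by_cases h : ∃ i j : Fin r, i ≠ j
  · obtain ⟨i₀, j₀, h₀⟩ := h
    refine ⟨b (hermDiag i₀) (hermDiag i₀), b (hermDiag i₀) (hermDiag j₀), fun i j => ?_⟩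
    split_ifs with hij
    · rw [hij]; exact hd _ _
    by_cases hj : j = i₀
    · subst hj
      rw [hs (hermDiag j) (hermDiag j₀)]
      exact ho _ _ _ (Ne.symm hij) h₀
    · rw [ho i i₀ j (Ne.symm hij) hj, hs, hs _ (hermDiag j₀)]
      exact ho _ _ _ (Ne.symm hj) h₀
  · push Not at h
    by_cases h' : Nonempty (Fin r)
    · obtain ⟨i₀⟩ := h'
      refine ⟨b (hermDiag i₀) (hermDiag i₀), 0, fun i j => ?_⟩
      rw [if_pos (h i j), h i i₀, h j i₀]
    · exact ⟨0, 0, fun i => (h' ⟨i⟩).elim⟩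

/-- An invariant form that vanishes on the diagonal matrices is zero. -/
lemma IsAdInvariant.eq_zero (hb : IsAdInvariant b) (hs : ∀ K L, b K L = b L K)
    (hd : ∀ i j, b (hermDiag i) (hermDiag j) = 0) {K L : Mat r} (hK : IsHerm K) (hL : IsHerm L) :
    b K L = 0 := by
  have hone : ∀ {i j : Fin r}, i ≠ j → ∀ {q}, IsQuat q →
      b (hermUnit 1 i j) (hermUnit q i j) = 0 := by
    intro i j hij q hq
    let φ : Mat4 →ₗ[ℝ] ℝ :=
      b (hermUnit 1 i j) ∘ₗ (krL (single i j 1) +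
        krL (single j i 1) ∘ₗ (transposeLinearEquiv _ _ ℝ ℝ).toLinearMap)
    refine IsQuat.map_eq_zero (φ := φ) ?_ ?_ hq
    · change b (hermUnit 1 i j) (hermUnit 1 i j) = 0
      rw [hb.diag_rel hij, hd, hd, sub_zero, mul_zero]
    · intro p hp
      change b (hermUnit 1 i j) (hermUnit p i j) = 0
      -- Acting by `p e_ii` on both copies of the real unit gives `2 b(1, p) = 0` for the
      -- coefficients.
      have h := hb _ (isComm_imDiag hp i) (imDiag_transpose hp i) _ _
        (isHerm_hermUnit IsQuat.one i j) (isHerm_hermUnit IsQuat.one i j)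
      rw [imDiag_ad_hermUnit hp _ hij, mul_one, hs] at h
      linarith
  have hsame : ∀ {i j : Fin r}, i ≠ j → ∀ {q q'}, IsQuat q → IsQuat q' →
      b (hermUnit q i j) (hermUnit q' i j) = 0 := by
    intro i j hij q q' hq hq'
    let φ : Mat4 →ₗ[ℝ] ℝ :=
      b (hermUnit q' i j) ∘ₗ (krL (single i j 1) +
        krL (single j i 1) ∘ₗ (transposeLinearEquiv _ _ ℝ ℝ).toLinearMap)
    rw [hs]
    refine IsQuat.map_eq_zero (φ := φ) ?_ ?_ hq
    · change b (hermUnit q' i j) (hermUnit 1 i j) = 0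
      rw [hs, hone hij hq']
    · intro p hp
      change b (hermUnit q' i j) (hermUnit p i j) = 0
      -- Now `b(p, q') + b(1, p q') = 0`, and the second term vanishes by the case of coefficient
      -- `1`.
      have h := hb _ (isComm_imDiag hp i) (imDiag_transpose hp i) _ _
        (isHerm_hermUnit IsQuat.one i j) (isHerm_hermUnit hq' i j)
      rw [imDiag_ad_hermUnit hp _ hij, imDiag_ad_hermUnit hp _ hij, mul_one,
        hone hij (hp.isQuat.mul hq'), add_zero] at h
      rw [hs, h]
  have hoff : ∀ {i j k l : Fin r}, i ≠ j → ∀ {q q'}, IsQuat q → IsQuat q' →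
      b (hermUnit q i j) (hermUnit q' k l) = 0 := by
    intro i j k l hij q q' hq hq'
    -- Unless `{i, j} = {k, l}`, one of `i`, `j` avoids both other indices; the swapped case reduces
    -- to the equal one by conjugating the coefficient.
    by_cases hi : i ≠ k ∧ i ≠ l
    · exact hb.hermUnit_of_ne hq hq' hij hi.1 hi.2
    by_cases hj : j ≠ k ∧ j ≠ l
    · rw [← hermUnit_transpose q j i]
      exact hb.hermUnit_of_ne hq.transpose hq' hij.symm hj.1 hj.2
    by_cases hik : i = k
    · have hjl : j = l := by
        by_contra hne
        exact hj ⟨fun h => hij (hik.trans h.symm), hne⟩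
      subst hik hjl
      exact hsame hij hq hq'
    · have hil : i = l := by
        by_contra hne
        exact hi ⟨hik, hne⟩
      have hjk : j = k := by
        by_contra hne
        exact hj ⟨hne, fun h => hij (hil.trans h.symm)⟩
      subst hil hjk
      rw [← hermUnit_transpose q' i j]
      exact hsame hij hq hq'.transpose
  have hall : ∀ {i j k l : Fin r} {q q'}, IsQuat q → IsQuat q' →
      b (hermUnit q i j) (hermUnit q' k l) = 0 := by
    intro i j k l q q' hq hq'
    by_cases hij : i = j
    · by_cases hkl : k = l
      · subst hij hkl
        rw [hermUnit_self hq, hermUnit_self hq']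
        simp [hd]
      · rw [hs]
        exact hoff hkl hq' hq
    · exact hoff hij hq hq'
  rw [hK.eq_sum, hL.eq_sum]
  simp only [map_smul, map_sum, LinearMap.smul_apply, LinearMap.sum_apply]
  simp [hall (hK.1.isQuat _ _) (hL.1.isQuat _ _)]

end Invariant

/-- The invariant form `c tr(KL) + ν tr(K) tr(L)`. -/
noncomputable def traceForm (c ν : ℝ) : LinearMap.BilinForm ℝ (Mat r) :=
  LinearMap.mk₂ ℝ (fun K L => c * (K * L).trace + ν * (K.trace * L.trace))
    (fun K K' L => by rw [add_mul, trace_add, trace_add]; ring)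
    (fun t K L => by
      simp only [smul_mul_assoc, trace_smul, smul_eq_mul]
      ring)
    (fun K L L' => by rw [mul_add, trace_add, trace_add]; ring)
    (fun t K L => by
      simp only [mul_smul_comm, trace_smul, smul_eq_mul]
      ring)

lemma traceForm_apply (c ν : ℝ) (K L : Mat r) :
    traceForm c ν K L = c * (K * L).trace + ν * (K.trace * L.trace) := rfl

lemma isAdInvariant_traceForm (c ν : ℝ) :
    IsAdInvariant (traceForm c ν : LinearMap.BilinForm ℝ (Mat r)) := by
  intro U _ _ K L _ _
  rw [traceForm_apply, traceForm_apply, trace_sub, trace_mul_comm U K, trace_sub,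
    trace_mul_comm U L, sub_mul, mul_sub, trace_sub, trace_sub, mul_assoc U, trace_mul_comm U,
    mul_assoc K U, mul_assoc K L]
  ring

/-- Invariant symmetric forms on Hermitian quaternionic matrices. -/
lemma IsAdInvariant.exists_traceForm {b : LinearMap.BilinForm ℝ (Mat r)} (hb : IsAdInvariant b)
    (hs : ∀ K L, b K L = b L K) :
    ∃ c ν : ℝ, ∀ K L, IsHerm K → IsHerm L →
      b K L = c * (K * L).trace + ν * (K.trace * L.trace) := by
  obtain ⟨x, y, hxy⟩ := hb.exists_diag hs
  -- As a real matrix `e_ii` has trace `4`, so the constants solve `4c + 16ν = x` and `16ν = y`.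
  refine ⟨(x - y) / 4, y / 16, fun K L hK hL => ?_⟩
  have key : (b - traceForm ((x - y) / 4) (y / 16) : LinearMap.BilinForm ℝ (Mat r)) K L = 0 := by
    refine IsAdInvariant.eq_zero ?_ ?_ ?_ hK hL
    · intro U hU hU' K L hK hL
      have h1 := hb U hU hU' K L hK hL
      have h2 := isAdInvariant_traceForm ((x - y) / 4) (y / 16) U hU hU' K L hK hL
      simp only [LinearMap.sub_apply]
      linarith
    · intro K L
      simp only [LinearMap.sub_apply, traceForm_apply]
      rw [hs K L, trace_mul_comm K L, mul_comm K.trace]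
    · intro i j
      have h4 : (1 : Mat4).trace = 4 := by
        rw [trace_one]; simp
      rw [LinearMap.sub_apply, LinearMap.sub_apply, traceForm_apply, hxy]
      simp only [hermDiag, kr_mul_kr, trace_kr, mul_one,
        h4, trace_single_eq_same]
      split_ifs with hij
      · subst hij
        rw [single_mul_single_same, trace_single_eq_same]
        ring
      · rw [single_mul_single_of_ne _ _ _ _ hij, trace_zero]
        ring
  rw [LinearMap.sub_apply, LinearMap.sub_apply, sub_eq_zero] at key
  exact key

/-! ### The quadratic form in terms of blocks -/

/-- The blocks of the first row of blocks of a matrix. -/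
def rowBlk (K : Mat r) (k : Fin 2 × Fin 2) : Matrix (Fin r) (Fin r) ℝ :=
  of fun i j => entry4 K i j (0, 0) k

/-- The matrix of a quaternion `q` has squared Frobenius norm `4|q|²`, and its first row lists the
four components. -/
lemma IsQuat.sum_sq {q : Mat4} (hq : IsQuat q) :
    ∑ k, ∑ l, q k l ^ 2 = 4 * (q (0, 0) (0, 1) ^ 2 + q (0, 0) (1, 0) ^ 2 + q (0, 0) (1, 1) ^ 2
      + q (0, 0) (0, 0) ^ 2) := by
  have h : ∀ x y z t : ℝ, ∑ k, ∑ l, (x • (1 : Mat4) + y • quatI + z • quatJ + t • quatK) k l ^ 2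
      = 4 * (y ^ 2 + z ^ 2 + t ^ 2 + x ^ 2) := by
    intro x y z t
    simp [Fintype.sum_prod_type, quatI, quatJ, quatK, one_apply]
    ring
  rw [← h, ← hq.eq_sum]

lemma IsQuat.trace_eq {q : Mat4} (hq : IsQuat q) : q.trace = 4 * q (0, 0) (0, 0) := by
  have h := congrArg Matrix.trace hq.add_transpose
  rw [trace_add, trace_transpose, trace_smul, trace_one] at h
  simp at h
  linarith

lemma IsHerm.entry4_swap {K : Mat r} (hK : IsHerm K) (i j : Fin r) :
    entry4 K j i = (entry4 K i j)ᵀ := by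
  ext k l
  exact congrFun (congrFun hK.2.symm _) _

lemma IsHerm.rowBlk_symm {K : Mat r} (hK : IsHerm K) (i j : Fin r) :
    rowBlk K (0, 0) j i = rowBlk K (0, 0) i j := by
  simp [rowBlk, hK.entry4_swap i j]

lemma IsHerm.rowBlk_skew {K : Mat r} (hK : IsHerm K) {k : Fin 2 × Fin 2} (hk : k ≠ (0, 0))
    (i j : Fin r) : rowBlk K k j i = -rowBlk K k i j := by
  have h := congrFun (congrFun (hK.1.isQuat i j).add_transpose (0, 0)) k
  rw [Matrix.add_apply, Matrix.smul_apply, one_apply_ne hk.symm, smul_zero] at h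
  simp only [rowBlk, of_apply, hK.entry4_swap i j]
  linarith

lemma sum_sum_sq {X : Matrix (Fin r) (Fin r) ℝ} (h : ∀ i j, X j i ^ 2 = X i j ^ 2) :
    ∑ i, ∑ j, X i j ^ 2 = 2 * upperSq X + ∑ i, X i i ^ 2 := by
  have h1 : ∀ i, ∑ j, X i j ^ 2
      = ∑ j ∈ Finset.Ioi i, X i j ^ 2 + ∑ j ∈ Finset.Iio i, X i j ^ 2 + X i i ^ 2 := by
    intro i
    have hd : Disjoint (Finset.Ioi i) (Finset.Iio i) := by
      rw [Finset.disjoint_left]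
      intro j hj hj'
      exact absurd (Finset.mem_Ioi.1 hj) (not_lt.2 (Finset.mem_Iio.1 hj').le)
    rw [← Finset.sum_union hd, ← Finset.sum_erase_add _ _ (Finset.mem_univ i)]
    congr 2
    ext j
    simp only [Finset.mem_erase, Finset.mem_univ, and_true, Finset.mem_union, Finset.mem_Ioi,
      Finset.mem_Iio]
    exact ne_comm.trans lt_or_lt_iff_ne.symm
  have h2 : ∑ i, ∑ j ∈ Finset.Iio i, X i j ^ 2 = upperSq X := by
    rw [upperSq, Finset.sum_comm' (t' := Finset.univ) (s' := fun j => Finset.Ioi j)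
      (by simp)]
    exact Finset.sum_congr rfl fun i _ => Finset.sum_congr rfl fun j _ => h i j
  simp only [h1, Finset.sum_add_distrib, h2]
  rw [upperSq]
  ring

lemma sum_mul_sum_eq (f : Fin r → ℝ) :
    (∑ i, f i) * ∑ i, f i = ∑ i, f i ^ 2 + ∑ i, ∑ j ∈ Finset.univ.erase i, f i * f j := by
  rw [Finset.sum_mul_sum, ← Finset.sum_add_distrib]
  refine Finset.sum_congr rfl fun i _ => ?_
  rw [← Finset.add_sum_erase _ _ (Finset.mem_univ i), sq]

/-- Each square above the diagonal occurs twice in the full sum, whence `8c`; a diagonal square gets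
`4c` from that sum and `16ν` from the squared trace, whose cross terms have coefficient `16ν = λ₂ -
λ₁/2`. -/
lemma qForm_eq (c ν : ℝ) {P₁ P₂ P₃ Q : Matrix (Fin r) (Fin r) ℝ}
    (h₁ : ∀ i j, P₁ j i = -P₁ i j) (h₂ : ∀ i j, P₂ j i = -P₂ i j)
    (h₃ : ∀ i j, P₃ j i = -P₃ i j) (hQ : ∀ i j, Q j i = Q i j) :
    qForm (8 * c) (4 * c + 16 * ν) P₁ P₂ P₃ Q =
      c * (4 * ∑ i, ∑ j, (P₁ i j ^ 2 + P₂ i j ^ 2 + P₃ i j ^ 2 + Q i j ^ 2))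
        + ν * (4 * ∑ i, Q i i) * (4 * ∑ i, Q i i) := by
  have hskew : ∀ {P : Matrix (Fin r) (Fin r) ℝ}, (∀ i j, P j i = -P i j) →
      ∑ i, ∑ j, P i j ^ 2 = 2 * upperSq P := by
    intro P hP
    have h0 : ∀ i, P i i = 0 := fun i => by linarith [hP i i]
    rw [sum_sum_sq fun i j => by rw [hP i j, neg_sq]]
    simp [h0]
  have hsq := sum_mul_sum_eq fun i => Q i i
  simp only [Finset.sum_add_distrib, hskew h₁, hskew h₂, hskew h₃,
    sum_sum_sq (X := Q) fun i j => by rw [hQ i j]]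
  rw [qForm]
  linear_combination (-16 * ν) * hsq

lemma IsHerm.traceForm_self {K : Mat r} (hK : IsHerm K) (c ν : ℝ) :
    c * (K * K).trace + ν * (K.trace * K.trace) =
      qForm (8 * c) (4 * c + 16 * ν) (rowBlk K (0, 1)) (rowBlk K (1, 0)) (rowBlk K (1, 1))
        (rowBlk K (0, 0)) := by
  have h1 : (K * K).trace = 4 * ∑ i, ∑ j, (rowBlk K (0, 1) i j ^ 2 + rowBlk K (1, 0) i j ^ 2
      + rowBlk K (1, 1) i j ^ 2 + rowBlk K (0, 0) i j ^ 2) := by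
    have h : (K * K).trace = ∑ a, ∑ b, K a b ^ 2 := by
      simp only [Matrix.trace, diag_apply, Matrix.mul_apply]
      refine Finset.sum_congr rfl fun a _ => Finset.sum_congr rfl fun b _ => ?_
      rw [sq]
      congr 1
      exact congrFun (congrFun hK.2.symm _) _
    simp only [h, sum_idx, Finset.mul_sum]
    rw [Finset.sum_comm]
    refine Finset.sum_congr rfl fun i _ => ?_
    simp only [Finset.sum_comm (s := (Finset.univ : Finset (Fin 2 × Fin 2)))
      (t := (Finset.univ : Finset (Fin r)))]
    exact Finset.sum_congr rfl fun j _ => (hK.1.isQuat i j).sum_sq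
  have h2 : K.trace = 4 * ∑ i, rowBlk K (0, 0) i i := by
    rw [Matrix.trace, sum_idx, Finset.sum_comm, Finset.mul_sum]
    exact Finset.sum_congr rfl fun i _ => (hK.1.isQuat i i).trace_eq
  rw [qForm_eq c ν (hK.rowBlk_skew (by simp)) (hK.rowBlk_skew (by simp))
    (hK.rowBlk_skew (by simp)) hK.rowBlk_symm, h1, h2]
  ring

/-! ### The graded pieces -/

/-- The index `δ` for which `J_δ` lies in the component of degree `γ`. -/
def Gam.dual : Gam → Gam
  | .e => .e
  | .a => .b
  | .b => .a
  | .c => .c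

lemma Jb_mul_Ja : Jb r * Ja r = -(Ja r * Jb r) := by
  rw [Ja_eq, Jb_eq, kr_mul_kr, kr_mul_kr, ← kr_neg]
  congr 1
  rw [ja, jb, ← mul_kronecker_mul, ← mul_kronecker_mul]
  ext ⟨k, k'⟩ ⟨l, l'⟩
  fin_cases k <;> fin_cases k' <;> fin_cases l <;> fin_cases l' <;> simp

lemma Ja_transpose : (Ja r)ᵀ = -Ja r := by
  rw [Ja_eq, kr_transpose, ja_transpose, transpose_one, kr_neg]

lemma Jb_transpose : (Jb r)ᵀ = -Jb r := by
  rw [Jb_eq, kr_transpose, jb_transpose, transpose_one, kr_neg]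

lemma J_e_coe : (J r .e).1 = 1 := rfl
lemma J_a_coe : (J r .a).1 = Ja r := rfl
lemma J_b_coe : (J r .b).1 = Jb r := rfl
lemma J_c_coe : (J r .c).1 = Ja r * Jb r := rfl

lemma J_transpose {γ : Gam} (hγ : γ ≠ .e) : ((J r γ).1)ᵀ = -(J r γ).1 := by
  cases γ
  · exact absurd rfl hγ
  · exact Ja_transpose
  · exact Jb_transpose
  · rw [J_c_coe, transpose_mul, Ja_transpose, Jb_transpose, neg_mul_neg, Jb_mul_Ja]

lemma J_mul_self {γ : Gam} (hγ : γ ≠ .e) : (J r γ).1 * (J r γ).1 = -1 := by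
  have h := SO_mul_transpose (J r γ)
  rw [J_transpose hγ, mul_neg] at h
  rw [← h, neg_neg]

/-- `J_{γ.dual}` has the same commutation signs as `𝔤_γ`, so multiplying by it cancels them. -/
lemma J_dual_mul_J (γ δ : Gam) :
    (J r γ.dual).1 * (J r δ).1 = sign γ δ • ((J r δ).1 * (J r γ.dual).1) := by
  have h := Jb_mul_Ja (r := r)
  have h' : ∀ X, Jb r * (Ja r * X) = -(Ja r * (Jb r * X)) := by
    intro X
    rw [← mul_assoc, h, neg_mul, mul_assoc]
  cases γ <;> cases δ <;>
    simp [Gam.dual, sign, J_e_coe, J_a_coe, J_b_coe, J_c_coe, h, h', mul_assoc]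

lemma sign_mul_self (γ δ : Gam) : sign γ δ * sign γ δ = 1 := by
  cases γ <;> cases δ <;> simp [sign]

lemma sign_dual (γ : Gam) : sign γ γ.dual = 1 := by cases γ <;> rfl

lemma dual_ne_e {γ : Gam} (hγ : γ ≠ .e) : γ.dual ≠ .e := by
  cases γ <;> simp_all [Gam.dual]

lemma mem_grade_iff (γ : Gam) (V : so r) :
    V ∈ grade r γ ↔ ∀ δ, V.1 * (J r δ).1 = sign γ δ • ((J r δ).1 * V.1) := by
  refine forall_congr' fun δ => ?_
  rw [tau_eq_iff, mul_smul_comm]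

lemma isComm_iff (K : Mat r) : IsComm K ↔ ∀ γ, K * (J r γ).1 = (J r γ).1 * K := by
  constructor
  · rintro ⟨h1, h2⟩ γ
    cases γ
    · rw [J_e_coe, mul_one, one_mul]
    · exact h1
    · exact h2
    · rw [J_c_coe, ← mul_assoc, h1, mul_assoc, h2, mul_assoc]
  · exact fun h => ⟨h .a, h .b⟩

/-- The Hermitian matrix that determines an element of degree `γ`. -/
def toHerm (γ : Gam) (V : so r) : Mat r := -((J r γ.dual).1 * V.1)

lemma J_mul_toHerm {γ : Gam} (hγ : γ ≠ .e) (V : so r) :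
    (J r γ.dual).1 * toHerm γ V = V.1 := by
  rw [toHerm, mul_neg, ← mul_assoc, J_mul_self (dual_ne_e hγ), neg_one_mul, neg_neg]

/-- The signs of `V` and of `J_{γ.dual}` cancel, so the product commutes with all `J_δ`; it is
symmetric because the two factors are skew and commute. -/
lemma isHerm_toHerm {γ : Gam} (hγ : γ ≠ .e) {V : so r} (hV : V ∈ grade r γ) :
    IsHerm (toHerm γ V) := by
  rw [mem_grade_iff] at hV
  constructor
  · rw [isComm_iff]
    intro δ
    rw [toHerm, neg_mul, mul_neg, mul_assoc, hV δ, mul_smul_comm, ← mul_assoc, J_dual_mul_J,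
      smul_mul_assoc, smul_smul, sign_mul_self, one_smul, mul_assoc]
  · have h := hV γ.dual
    rw [sign_dual, one_smul] at h
    rw [toHerm, transpose_neg, transpose_mul, so_transpose, J_transpose (dual_ne_e hγ), neg_mul_neg,
      h]

lemma J_mul_mem_so {γ : Gam} (hγ : γ ≠ .e) {K : Mat r} (hK : IsHerm K) :
    (J r γ.dual).1 * K ∈ so r := by
  rw [mem_so_iff, transpose_mul, hK.2, J_transpose (dual_ne_e hγ), mul_neg,
    (isComm_iff K).1 hK.1]

/-- An `ad(𝔤_e)`-invariant symmetric form on the component of degree `γ`. -/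
lemma exists_traceForm_grade {B : LinearMap.BilinForm ℝ (so r)} (hs : ∀ V W, B V W = B W V)
    (had : ∀ U ∈ grade r .e, ∀ V W, B ⁅U, V⁆ W + B V ⁅U, W⁆ = 0) {γ : Gam} (hγ : γ ≠ .e) :
    ∃ c ν : ℝ, ∀ V ∈ grade r γ, B V V =
      qForm (8 * c) (4 * c + 16 * ν) (rowBlk (toHerm γ V) (0, 1)) (rowBlk (toHerm γ V) (1, 0))
        (rowBlk (toHerm γ V) (1, 1)) (rowBlk (toHerm γ V) (0, 0)) := by
  let N : Mat r := (J r γ.dual).1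
  -- The skew part only makes the map total; on Hermitian `K` the product `N K` is already skew.
  let f : Mat r →ₗ[ℝ] so r := skewPart ∘ₗ LinearMap.mulLeft ℝ N
  have hf : ∀ {K : Mat r} (hK : IsHerm K), f K = ⟨N * K, J_mul_mem_so hγ hK⟩ :=
    fun {K} hK => skewPart_coe ⟨N * K, J_mul_mem_so hγ hK⟩
  have hb : IsAdInvariant (B.comp f f) := by
    intro U hU hU' K L hK hL
    have hUe : (⟨U, (mem_so_iff U).2 hU'⟩ : so r) ∈ grade r .e := by
      rw [mem_grade_e]
      exact (isComm_iff U).1 hU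
    have key : ∀ {K : Mat r}, IsHerm K →
        f (U * K - K * U) = ⁅(⟨U, (mem_so_iff U).2 hU'⟩ : so r), f K⁆ := by
      intro K hK
      rw [hf hK, ← skewPart_coe ⁅_, _⁆]
      change skewPart (N * (U * K - K * U)) = skewPart (U * (N * K) - N * K * U)
      -- `U ∈ 𝔤_e` commutes with `N`, so left multiplication by `N` intertwines the two brackets.
      rw [mul_sub, ← mul_assoc N U, ← (isComm_iff U).1 hU, mul_assoc U, mul_assoc N K]
    change B (f (U * K - K * U)) (f L) + B (f K) (f (U * L - L * U)) = 0
    rw [key hK, key hL]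
    exact had _ hUe _ _
  obtain ⟨c, ν, h⟩ := hb.exists_traceForm fun K L => hs _ _
  refine ⟨c, ν, fun V hV => ?_⟩
  have hK := isHerm_toHerm hγ hV
  rw [← hK.traceForm_self, ← h _ _ hK hK]
  change B V V = B (f (toHerm γ V)) (f (toHerm γ V))
  have hfV : f (toHerm γ V) = V := by
    rw [hf hK]
    exact Subtype.ext (J_mul_toHerm hγ V)
  rw [hfV]

lemma blk_eq_of_kr {γ : Gam} (hγ : γ ≠ .e) {n : Mat4} (hn : (J r γ.dual).1 = kr n 1) (V : so r)
    (p q : Fin 2) :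
    blk p q V = of fun i j => (n * entry4 (toHerm γ V) i j) (0, 0) (p, q) := by
  ext i j
  rw [of_apply, ← entry4_kr_one_mul, ← hn, J_mul_toHerm hγ]
  rfl

/-- `qForm` is even in the symmetric block and symmetric in the skew ones: the signs and the order
produced by multiplying with `J` do not matter. -/
lemma qForm_congr (l₁ l₂ : ℝ) {P₁ P₂ P₃ Q P₁' P₂' P₃' Q' : Matrix (Fin r) (Fin r) ℝ}
    (hP : ∀ i j, P₁ i j ^ 2 + P₂ i j ^ 2 + P₃ i j ^ 2 = P₁' i j ^ 2 + P₂' i j ^ 2 + P₃' i j ^ 2)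
    (hQ : Q = Q' ∨ Q = -Q') : qForm l₁ l₂ P₁ P₂ P₃ Q = qForm l₁ l₂ P₁' P₂' P₃' Q' := by
  have h : upperSq P₁ + upperSq P₂ + upperSq P₃ = upperSq P₁' + upperSq P₂' + upperSq P₃' := by
    simp only [upperSq, ← Finset.sum_add_distrib, hP]
  rw [qForm, qForm, h]
  rcases hQ with rfl | rfl <;> simp [upperSq]

lemma exists_qa {B : LinearMap.BilinForm ℝ (so r)} (hs : ∀ V W, B V W = B W V)
    (had : ∀ U ∈ grade r .e, ∀ V W, B ⁅U, V⁆ W + B V ⁅U, W⁆ = 0) :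
    ∃ l₁ l₂ : ℝ, ∀ V ∈ grade r .a, B V V = qa l₁ l₂ V := by
  obtain ⟨c, ν, h⟩ := exists_traceForm_grade hs had (γ := .a) (by simp)
  refine ⟨8 * c, 4 * c + 16 * ν, fun V hV => ?_⟩
  have hK := isHerm_toHerm (by simp) hV
  rw [h V hV, qa]
  simp only [blk_eq_of_kr (γ := .a) (by simp) Jb_eq]
  -- The first row of `jb q` is a row of `q`, so the blocks of `V` are, up to sign and order, the
  -- quaternion components of `toHerm .a V`; the real part lands in `T`.
  have hrow : ∀ i j k, (jb * entry4 (toHerm .a V) i j) (0, 0) k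
      = entry4 (toHerm .a V) i j (1, 1) k := by
    intro i j k
    simp [Matrix.mul_apply, Fintype.sum_prod_type, jb]
  simp only [hrow]
  have hq := fun i j => (hK.1.isQuat i j).eq_sum
  have hent := fun i j k => congrFun (congrFun (hq i j) (1, 1)) k
  refine qForm_congr _ _ (fun i j => ?_) (Or.inl ?_)
  · simp only [of_apply, rowBlk]
    rw [hent i j (0, 0), hent i j (0, 1), hent i j (1, 0)]
    simp [quatI, quatJ, quatK, one_apply]
    ring
  · ext i j
    simp only [of_apply, rowBlk]
    rw [hent i j (1, 1)]
    simp [quatI, quatJ, quatK, one_apply]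

lemma exists_qb {B : LinearMap.BilinForm ℝ (so r)} (hs : ∀ V W, B V W = B W V)
    (had : ∀ U ∈ grade r .e, ∀ V W, B ⁅U, V⁆ W + B V ⁅U, W⁆ = 0) :
    ∃ l₁ l₂ : ℝ, ∀ V ∈ grade r .b, B V V = qb l₁ l₂ V := by
  obtain ⟨c, ν, h⟩ := exists_traceForm_grade hs had (γ := .b) (by simp)
  refine ⟨8 * c, 4 * c + 16 * ν, fun V hV => ?_⟩
  have hK := isHerm_toHerm (by simp) hV
  rw [h V hV, qb]
  simp only [blk_eq_of_kr (γ := .b) (by simp) Ja_eq]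
  have hrow : ∀ i j k, (ja * entry4 (toHerm .b V) i j) (0, 0) k
      = -entry4 (toHerm .b V) i j (0, 1) k := by
    intro i j k
    simp [Matrix.mul_apply, Fintype.sum_prod_type, ja]
  simp only [hrow]
  have hq := fun i j => (hK.1.isQuat i j).eq_sum
  have hent := fun i j k => congrFun (congrFun (hq i j) (0, 1)) k
  refine qForm_congr _ _ (fun i j => ?_) (Or.inr ?_)
  · simp only [of_apply, rowBlk]
    rw [hent i j (0, 0), hent i j (1, 0), hent i j (1, 1)]
    simp [quatI, quatJ, quatK, one_apply]
    ring
  · ext i j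
    simp only [of_apply, rowBlk, Matrix.neg_apply]
    rw [hent i j (0, 1)]
    simp [quatI, quatJ, quatK, one_apply]

lemma exists_qc {B : LinearMap.BilinForm ℝ (so r)} (hs : ∀ V W, B V W = B W V)
    (had : ∀ U ∈ grade r .e, ∀ V W, B ⁅U, V⁆ W + B V ⁅U, W⁆ = 0) :
    ∃ l₁ l₂ : ℝ, ∀ V ∈ grade r .c, B V V = qc l₁ l₂ V := by
  obtain ⟨c, ν, h⟩ := exists_traceForm_grade hs had (γ := .c) (by simp)
  refine ⟨8 * c, 4 * c + 16 * ν, fun V hV => ?_⟩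
  have hK := isHerm_toHerm (by simp) hV
  have hn : (J r .c).1 = kr (ja * jb) 1 := by
    rw [J_c_coe, Ja_eq, Jb_eq, kr_mul_kr, mul_one]
  rw [h V hV, qc]
  simp only [blk_eq_of_kr (γ := .c) (by simp) hn]
  have hrow : ∀ i j k, (ja * jb * entry4 (toHerm .c V) i j) (0, 0) k
      = entry4 (toHerm .c V) i j (1, 0) k := by
    intro i j k
    simp [Matrix.mul_apply, Fintype.sum_prod_type, ja, jb]
  simp only [hrow]
  have hq := fun i j => (hK.1.isQuat i j).eq_sum
  have hent := fun i j k => congrFun (congrFun (hq i j) (1, 0)) k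
  refine qForm_congr _ _ (fun i j => ?_) (Or.inl ?_)
  · simp only [of_apply, rowBlk]
    rw [hent i j (0, 0), hent i j (0, 1), hent i j (1, 1)]
    simp [quatI, quatJ, quatK, one_apply]
    ring
  · ext i j
    simp only [of_apply, rowBlk]
    rw [hent i j (1, 0)]
    simp [quatI, quatJ, quatK, one_apply]

/-! ### The grading -/

/-- The four characters of `(ℤ/2)²` are distinct, and `a`, `b` generate the group, so one of these
two separates them. -/
lemma exists_sign_ne {γ δ : Gam} (h : γ ≠ δ) : ∃ ε, sign γ ε * sign δ ε = -1 := by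
  cases γ <;> cases δ <;> first
    | exact absurd rfl h
    | (refine ⟨.a, ?_⟩; simp [sign]; done)
    | exact ⟨.b, by simp [sign]⟩

lemma Ad_of_mem_grade {γ : Gam} {V : so r} (hV : V ∈ grade r γ) (δ : Gam) :
    Ad (J r δ)⁻¹ V = sign γ δ • V :=
  Subtype.ext (hV δ)

/-- A form invariant under the `τ_γ` makes the components of the grading orthogonal. -/
lemma orthogonal_of_Ad {B : LinearMap.BilinForm ℝ (so r)}
    (hB : ∀ γ V W, B (Ad (J r γ)⁻¹ V) (Ad (J r γ)⁻¹ W) = B V W) {γ δ : Gam} (h : γ ≠ δ)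
    {V W : so r} (hV : V ∈ grade r γ) (hW : W ∈ grade r δ) : B V W = 0 := by
  obtain ⟨ε, hε⟩ := exists_sign_ne h
  have h1 := hB ε V W
  rw [Ad_of_mem_grade hV, Ad_of_mem_grade hW, map_smul, map_smul, LinearMap.smul_apply,
    smul_eq_mul, smul_eq_mul, ← mul_assoc, mul_comm (sign δ ε), hε] at h1
  linarith

lemma tau_tau {γ : Gam} (hγ : γ ≠ .e) (V : Mat r) : tau γ (tau γ V) = V := by
  rw [tau, tau, SO_coe_inv, J_transpose hγ]
  calc -(J r γ).1 * (-(J r γ).1 * V * (J r γ).1) * (J r γ).1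
      = ((J r γ).1 * (J r γ).1) * V * ((J r γ).1 * (J r γ).1) := by
        simp only [neg_mul, mul_neg, neg_neg, mul_assoc]
    _ = V := by rw [J_mul_self hγ]; simp

lemma tau_c_eq (V : Mat r) : tau .c V = tau .b (tau .a V) := by
  simp only [tau, SO_coe_inv, J_a_coe, J_b_coe, J_c_coe, transpose_mul, mul_assoc]

lemma tau_a_tau_b (V : Mat r) : tau .a (tau .b V) = tau .b (tau .a V) := by
  simp only [tau, SO_coe_inv, J_a_coe, J_b_coe, Ja_transpose, Jb_transpose]
  calc -Ja r * (-Jb r * V * Jb r) * Ja r = Ja r * Jb r * V * (Jb r * Ja r) := by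
        simp only [neg_mul, mul_neg, neg_neg, mul_assoc]
    _ = Jb r * Ja r * V * (Ja r * Jb r) := by
        rw [Jb_mul_Ja, neg_mul, mul_neg, neg_mul]
    _ = -Jb r * (-Ja r * V * Ja r) * Jb r := by
        simp only [neg_mul, mul_neg, neg_neg, mul_assoc]

lemma tau_add (γ : Gam) (V W : Mat r) : tau γ (V + W) = tau γ V + tau γ W := by
  simp only [tau, mul_add, add_mul]

lemma tau_smul (γ : Gam) (t : ℝ) (V : Mat r) : tau γ (t • V) = t • tau γ V := by
  simp only [tau, mul_smul_comm, smul_mul_assoc]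

lemma mem_grade_of_a_b {γ : Gam} {V : so r} (ha : tau .a V.1 = sign γ .a • V.1)
    (hb : tau .b V.1 = sign γ .b • V.1) : V ∈ grade r γ := by
  intro δ
  cases δ
  · cases γ <;> simp [tau, J_e_coe, SO_coe_inv, sign]
  · exact ha
  · exact hb
  · rw [tau_c_eq, ha, tau_smul, hb, smul_smul]
    congr 1
    cases γ <;> simp [sign]

/-- The projection to the component of degree `γ`. -/
noncomputable def gradeProj (γ : Gam) (V : so r) : so r :=
  (4⁻¹ : ℝ) • (V + sign γ .a • Ad (J r .a)⁻¹ V + sign γ .b • Ad (J r .b)⁻¹ V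
    + (sign γ .a * sign γ .b) • Ad (J r .b)⁻¹ (Ad (J r .a)⁻¹ V))

lemma gradeProj_coe (γ : Gam) (V : so r) :
    (gradeProj γ V).1 = (4⁻¹ : ℝ) • (V.1 + sign γ .a • tau .a V.1 + sign γ .b • tau .b V.1
      + (sign γ .a * sign γ .b) • tau .b (tau .a V.1)) := rfl

/-- `gradeProj γ` averages over the group generated by the commuting involutions `τ_a`, `τ_b`,
weighted by the character of `γ`. -/
lemma gradeProj_mem (γ : Gam) (V : so r) : gradeProj γ V ∈ grade r γ := by
  apply mem_grade_of_a_b <;> rw [gradeProj_coe] <;>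
    simp only [tau_add, tau_smul, tau_tau, tau_a_tau_b, ne_eq, reduceCtorEq, not_false_eq_true]
  all_goals
    cases γ <;> simp only [sign] <;> module

lemma sum_gradeProj (V : so r) :
    V = gradeProj .e V + gradeProj .a V + gradeProj .b V + gradeProj .c V := by
  simp only [gradeProj, sign]
  module

lemma eq_zero_of_mem_grade_e {V : so r} (he : V ∈ grade r .e)
    (h : V ∈ grade r .a ⊔ grade r .b ⊔ grade r .c) : V = 0 := by
  obtain ⟨W, hW, Vc, hc, rfl⟩ := Submodule.mem_sup.1 h
  obtain ⟨Va, ha, Vb, hb, rfl⟩ := Submodule.mem_sup.1 hW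
  have h1 := fun δ => (he δ).symm
  change ∀ δ, _ = tau δ (Va.1 + Vb.1 + Vc.1) at h1
  simp only [tau_add, ha _, hb _, hc _] at h1
  have ea := h1 .a
  have eb := h1 .b
  have ec := h1 .c
  simp only [sign] at ea eb ec
  refine Subtype.ext ?_
  change Va.1 + Vb.1 + Vc.1 = 0
  change (1 : ℝ) • (Va.1 + Vb.1 + Vc.1) = _ at ea
  change (1 : ℝ) • (Va.1 + Vb.1 + Vc.1) = _ at eb
  change (1 : ℝ) • (Va.1 + Vb.1 + Vc.1) = _ at ec
  -- For `S = V_a + V_b + V_c`, each component has signs `-1, -1, 1` under the three `τ_δ`; adding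
  -- the equations gives `3S = -S`.
  linear_combination (norm := module) (4⁻¹ : ℝ) • ea + (4⁻¹ : ℝ) • eb + (4⁻¹ : ℝ) • ec

end SOSp

theorem mainTheorem3 (r : ℕ) (g : SOSp.Metric r) (hinv : g.IsInvariant) (hadapt : g.IsAdapted) :
    ∃ B : LinearMap.BilinForm ℝ (SOSp.so r),
      -- `g` is defined by `B`, and is the only invariant metric defined by `B`
      g.IsDefinedBy B ∧
      (∀ g' : SOSp.Metric r, g'.IsInvariant → g'.IsDefinedBy B → g' = g) ∧
      -- `B` is symmetric, with kernel `𝔤_e`: it is a non-degenerate form on `𝔤_a ⊕ 𝔤_b ⊕ 𝔤_c`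
      (∀ V W, B V W = B W V) ∧
      (∀ V, (∀ W, B V W = 0) ↔ V ∈ SOSp.grade r .e) ∧
      (∀ V ∈ SOSp.grade r .a ⊔ SOSp.grade r .b ⊔ SOSp.grade r .c,
        (∀ W ∈ SOSp.grade r .a ⊔ SOSp.grade r .b ⊔ SOSp.grade r .c, B V W = 0) → V = 0) ∧
      -- `B` is `ad(𝔤_e)`-invariant
      (∀ U ∈ SOSp.grade r .e, ∀ V W, B ⁅U, V⁆ W + B V ⁅U, W⁆ = 0) ∧
      -- the components are mutually orthogonal
      (∀ γ δ, γ ≠ δ → ∀ V ∈ SOSp.grade r γ, ∀ W ∈ SOSp.grade r δ, B V W = 0) ∧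
      -- `B = q_a + q_b + q_c`
      ∃ la₁ la₂ lb₁ lb₂ lc₁ lc₂ : ℝ,
        ∀ Va ∈ SOSp.grade r .a, ∀ Vb ∈ SOSp.grade r .b, ∀ Vc ∈ SOSp.grade r .c,
          B (Va + Vb + Vc) (Va + Vb + Vc) =
            SOSp.qa la₁ la₂ Va + SOSp.qb lb₁ lb₂ Vb + SOSp.qc lc₁ lc₂ Vc := by
  have hs := SOSp.baseForm_symm g
  have hker := SOSp.baseForm_ker g
  have had := fun U hU => SOSp.baseForm_ad hinv (U := U) hU
  have horth : ∀ γ δ, γ ≠ δ → ∀ V ∈ SOSp.grade r γ, ∀ W ∈ SOSp.grade r δ,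
      SOSp.baseForm g V W = 0 := fun γ δ h V hV W hW =>
    SOSp.orthogonal_of_Ad (SOSp.baseForm_tau hadapt) h hV hW
  refine ⟨SOSp.baseForm g, SOSp.isDefinedBy_baseForm hinv,
    fun g' _ h' => SOSp.eq_of_isDefinedBy (SOSp.isDefinedBy_baseForm hinv) h', hs, hker,
    fun V hV h => ?_, had, horth, ?_⟩
  · refine SOSp.eq_zero_of_mem_grade_e ((hker V).1 fun W => ?_) hV
    have ha : SOSp.grade r .a ≤ SOSp.grade r .a ⊔ SOSp.grade r .b ⊔ SOSp.grade r .c :=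
      le_sup_left.trans le_sup_left
    have hb : SOSp.grade r .b ≤ SOSp.grade r .a ⊔ SOSp.grade r .b ⊔ SOSp.grade r .c :=
      le_sup_right.trans le_sup_left
    have hc : SOSp.grade r .c ≤ SOSp.grade r .a ⊔ SOSp.grade r .b ⊔ SOSp.grade r .c :=
      le_sup_right
    -- The `𝔤_e` part of a test vector pairs to zero with everything, so orthogonality to the other
    -- three components already puts `V` in the kernel `𝔤_e`.
    rw [SOSp.sum_gradeProj W, map_add, map_add, map_add,
      h _ (ha (SOSp.gradeProj_mem .a W)), h _ (hb (SOSp.gradeProj_mem .b W)),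
      h _ (hc (SOSp.gradeProj_mem .c W)), hs, (hker _).2 (SOSp.gradeProj_mem .e W)]
    simp
  · obtain ⟨la₁, la₂, hqa⟩ := SOSp.exists_qa hs had
    obtain ⟨lb₁, lb₂, hqb⟩ := SOSp.exists_qb hs had
    obtain ⟨lc₁, lc₂, hqc⟩ := SOSp.exists_qc hs had
    refine ⟨la₁, la₂, lb₁, lb₂, lc₁, lc₂, fun Va ha Vb hb Vc hc => ?_⟩
    rw [← hqa Va ha, ← hqb Vb hb, ← hqc Vc hc]
    simp only [map_add, LinearMap.add_apply]
    rw [horth .a .b (by simp) Va ha Vb hb, horth .a .c (by simp) Va ha Vc hc,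
      horth .b .a (by simp) Vb hb Va ha, horth .b .c (by simp) Vb hb Vc hc,
      horth .c .a (by simp) Vc hc Va ha, horth .c .b (by simp) Vc hc Vb hb]
    ring
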